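/- Let $\mathbb F_q$ be a finite field, let $k\ge 0$ and $\ell\ge 0$ be integers, and let $\pi\colon F_k=\mathbb P(\mathcal O_{\mathbb P^1}\oplus\mathcal O_{\mathbb P^1}(-k))\to\mathbb P^1$ be the Hirzebruch surface over $\mathbb F_q$. For integers $m,n$ write $\mathcal O(m,n)=\mathcal O_{F_k}(m)\otimes\pi^*\mathcal O_{\mathbb P^1}(n)$, so that for $m\ge 0$ the space $H^0(F_k,\mathcal O(m,n))$ consists of the forms $\sum_{i=0}^m A_i(t_0,t_1)x^{m-i}y^i$ with $A_i\in\mathbb F_q[t_0,t_1]$ homogeneous of degree $n-ik$. An integral curve $Y\subseteq F_k$ is called horizontal if $\pi(Y)=\mathbb P^1$, equivalently if $\mathcal O(Y)\cong\mathcal O(m,n)$ with $m>0$. A section of $\mathcal O(m,n)$ is called horizontally irreducible if it is nonzero and its divisor has exactly one horizontal component, occurring with multiplicity one; otherwise (in particular if it is zero) it is called horizontally reducible. Let $D\subseteq\mathbb P^1$ be a reduced effective divisor, and let $\mathcal D\subseteq F_k$ be a $D$-marking, that is, a $0$-dimensional reduced closed subscheme contained in $\pi^{-1}(D)$ such that $\pi|_{\mathcal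 D}\colon\mathcal D\to D$ is an isomorphism. Let $$\alpha\colon H^0(F_k,\mathcal O(3,\ell))\to H^0(\mathcal D,\mathcal O(3,\ell)|_{\mathcal D})\cong H^0(\mathcal D,\mathcal O_{\mathcal D})$$ be the restriction map, for any choice of trivialization $\mathcal O(3,\ell)|_{\mathcal D}\cong\mathcal O_{\mathcal D}$. Suppose that $$\ell-2k\ \ge\ \frac{\deg D+k}{2}.$$ Then at least one of the following holds: 1. $\alpha$ is surjective; 2. every section $s\in\ker\alpha$ is horizontally reducible; moreover, there is an integral horizontal curve $C_0\subseteq F_k$ with $\mathcal O(C_0)\cong\mathcal O(1,h_0)$ for some integer $h_0\ge 0$, such that every $s\in\ker\alpha$ vanishes on $C_0$. -/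

import Mathlib

open MvPolynomial

noncomputable section

namespace Hirzebruch

/-- The algebraic closure of the base field `F`. Since a finite field is perfect, a reduced
`0`-dimensional closed subscheme of an `F`-scheme of finite type is the same thing as a finite set
of `AlgebraicClosure F`-points that is stable under the Galois group; closed points correspond to
Galois orbits, the degree of the subscheme is the number of geometric points, and its ring of
functions consists of the Galois-equivariant functions with values in the algebraic closure. -/
abbrev Geom (F : Type*) [Field F] : Type _ := AlgebraicClosure F

/-- The absolute Galois group of `F`. -/
abbrev GalGroup (F : Type*) [Field F] : Type _ := Geom F ≃ₐ[F] Geom F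

/-! ### The base `ℙ¹` and its reduced effective divisors -/

section Base

variable (F : Type*) [Field F]

/-- The geometric points `[t₀ : t₁]` of `ℙ¹` over `F`. -/
abbrev BasePoint : Type _ := Projectivization (Geom F) (Fin 2 → Geom F)

variable {F}

/-- A Galois automorphism acting on coordinate vectors, as a semilinear map. -/
def galVec (σ : GalGroup F) :
    (Fin 2 → Geom F) →ₛₗ[(σ.toRingEquiv : Geom F →+* Geom F)] (Fin 2 → Geom F) where
  toFun v := fun i => σ (v i)
  map_add' u v := by ext i; simp
  map_smul' a v := by ext i; simp

theorem galVec_injective (σ : GalGroup F) : Function.Injective (galVec σ) := by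
  intro u v h
  funext i
  exact σ.injective (congrFun h i)

/-- The Galois action `[t₀ : t₁] ↦ [σ t₀ : σ t₁]` on geometric points of `ℙ¹`. -/
def BasePoint.gal (σ : GalGroup F) : BasePoint F → BasePoint F :=
  Projectivization.map (galVec σ) (galVec_injective σ)

variable (F)

/-- A reduced effective divisor on `ℙ¹` over `F` (a finite union of closed points), given by its
set of geometric points. -/
structure ReducedDivisor where
  points : Set (BasePoint F)
  finite : points.Finite
  gal_mem : ∀ (σ : GalGroup F), ∀ P ∈ points, BasePoint.gal σ P ∈ points

variable {F}

/-- The degree of a reduced effective divisor: the number of its geometric points, that is, the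
sum of the degrees over `F` of the residue fields of its closed points. -/
def ReducedDivisor.degree (D : ReducedDivisor F) : ℕ := D.points.ncard

end Base

/-! ### Line bundles on `F_k` and their global sections -/

/-- The bidegrees of the homogeneous coordinates of `F_k = ℙ(𝒪 x ⊕ 𝒪(-k) y)`. The index `inl i`
is the coordinate `t_i` of the base, of bidegree `(0, 1)`; `inr 0` is the fibre coordinate `x`, of
bidegree `(1, 0)`; `inr 1` is the fibre coordinate `y`, of bidegree `(1, k)`. -/
def bidegree (k : ℕ) : Fin 2 ⊕ Fin 2 → ℕ × ℕ :=
  Sum.elim (fun _ => (0, 1)) ![(1, 0), (1, k)]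

/-- `H⁰(F_k, 𝒪(m, ℓ))` for `m, ℓ ≥ 0`, where `𝒪(m, ℓ) = 𝒪(m) ⊗ π^* 𝒪(ℓ)`: the bihomogeneous forms
`A₀ x^m + A₁ x^(m-1) y + ⋯ + A_m y^m`, with `A_i ∈ F[t₀, t₁]` homogeneous of degree `ℓ - i k`
(and `A_i = 0` if `ℓ < i k`). -/
abbrev globalSections (F : Type*) [Field F] (k m l : ℕ) :
    Submodule F (MvPolynomial (Fin 2 ⊕ Fin 2) F) :=
  weightedHomogeneousSubmodule F (bidegree k) (m, l)

/-- The form `p` cuts out an integral curve `Y ⊆ F_k` over `F` with `𝒪(Y) ≅ 𝒪(m, n)`. Every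
integral curve is cut out by such a form, unique up to a nonzero constant. -/
def IsIntegralCurve {F : Type*} [Field F] (k m n : ℕ) (p : MvPolynomial (Fin 2 ⊕ Fin 2) F) :
    Prop :=
  p ∈ globalSections F k m n ∧ Irreducible p

/-- An integral curve `Y` is horizontal if `𝒪(Y) ≅ 𝒪(m, n)` with `m > 0`; the other integral
curves are the fibres over closed points of `ℙ¹`. -/
def IsHorizontalCurve {F : Type*} [Field F] (k : ℕ) (p : MvPolynomial (Fin 2 ⊕ Fin 2) F) : Prop :=
  ∃ m n : ℕ, 0 < m ∧ IsIntegralCurve k m n p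

/-- The section `s` is nonzero and its divisor has exactly one horizontal component, which
occurs with multiplicity one. -/
def HorizontallyIrreducible {F : Type*} [Field F] (k : ℕ)
    (s : MvPolynomial (Fin 2 ⊕ Fin 2) F) : Prop :=
  s ≠ 0 ∧ ∃ p, IsHorizontalCurve k p ∧ p ∣ s ∧ ¬ p ^ 2 ∣ s ∧
    ∀ p', IsHorizontalCurve k p' → p' ∣ s → Associated p p'

/-- Horizontally reducible means not horizontally irreducible; the zero section is horizontally
reducible. -/
def HorizontallyReducible {F : Type*} [Field F] (k : ℕ)
    (s : MvPolynomial (Fin 2 ⊕ Fin 2) F) : Prop :=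
  ¬ HorizontallyIrreducible k s

/-! ### Geometric points of `F_k` -/

section Surface

/-- Homogeneous coordinates `(t₀, t₁; x, y)` of a geometric point of `F_k`: two nonzero vectors. -/
@[ext]
structure Coords (F : Type*) [Field F] where
  t : Fin 2 → Geom F
  z : Fin 2 → Geom F
  t_ne : t ≠ 0
  z_ne : z ≠ 0

variable {F : Type*} [Field F]

/-- The four coordinates as one family, for evaluating forms. -/
def Coords.val (v : Coords F) : Fin 2 ⊕ Fin 2 → Geom F := Sum.elim v.t v.z

/-- The action `(t₀, t₁; x, y) ↦ (a t₀, a t₁; b x, b a^k y)` of the torus. -/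
def Coords.scale (k : ℕ) (a b : (Geom F)ˣ) (v : Coords F) : Coords F where
  t := fun i => a * v.t i
  z := ![b * v.z 0, b * a ^ k * v.z 1]
  t_ne := by
    intro h
    apply v.t_ne
    funext i
    have := congrFun h i
    simpa using this
  z_ne := by
    intro h
    apply v.z_ne
    funext i
    have := congrFun h i
    fin_cases i <;> simpa using this

/-- The Galois action on homogeneous coordinates. -/
def Coords.gal (σ : GalGroup F) (v : Coords F) : Coords F where
  t := fun i => σ (v.t i)
  z := fun i => σ (v.z i)
  t_ne := by
    intro h
    apply v.t_ne
    funext i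
    have := congrFun h i
    simpa using this
  z_ne := by
    intro h
    apply v.z_ne
    funext i
    have := congrFun h i
    simpa using this

theorem Coords.scale_one (k : ℕ) (v : Coords F) : Coords.scale k 1 1 v = v := by
  ext i
  · simp [Coords.scale]
  · fin_cases i <;> simp [Coords.scale]

theorem Coords.scale_scale (k : ℕ) (a b a' b' : (Geom F)ˣ) (v : Coords F) :
    Coords.scale k a b (Coords.scale k a' b' v) = Coords.scale k (a * a') (b * b') v := by
  ext i
  · simp [Coords.scale, mul_assoc]
  · fin_cases i <;> simp [Coords.scale] <;> ring

theorem Coords.gal_scale (k : ℕ) (σ : GalGroup F) (a b : (Geom F)ˣ) (v : Coords F) :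
    Coords.gal σ (Coords.scale k a b v) =
      Coords.scale k (Units.map (σ : Geom F →* Geom F) a) (Units.map (σ : Geom F →* Geom F) b)
        (Coords.gal σ v) := by
  ext i
  · simp [Coords.scale, Coords.gal]
  · fin_cases i <;> simp [Coords.scale, Coords.gal]

variable (F)

/-- Two coordinate vectors give the same point of `F_k` if they differ by the torus action. -/
def coordsSetoid (k : ℕ) : Setoid (Coords F) where
  r v w := ∃ a b : (Geom F)ˣ, v = Coords.scale k a b w
  iseqv :=
    { refl := fun v => ⟨1, 1, (Coords.scale_one k v).symm⟩
      symm := by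
        rintro v w ⟨a, b, rfl⟩
        exact ⟨a⁻¹, b⁻¹, by rw [Coords.scale_scale]; simp [Coords.scale_one]⟩
      trans := by
        rintro u v w ⟨a, b, rfl⟩ ⟨a', b', rfl⟩
        exact ⟨a * a', b * b', Coords.scale_scale k a b a' b' w⟩ }

/-- The geometric points of the Hirzebruch surface `F_k` over `F`. -/
def Point (k : ℕ) : Type _ := Quotient (coordsSetoid F k)

variable {F}

/-- The point with given homogeneous coordinates. -/
def Point.mk (k : ℕ) (v : Coords F) : Point F k := Quotient.mk (coordsSetoid F k) v

/-- A choice of homogeneous coordinates of a point. -/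
def Point.rep {k : ℕ} (p : Point F k) : Coords F := Quotient.out p

theorem Point.mk_rep {k : ℕ} (p : Point F k) : Point.mk k p.rep = p := Quotient.out_eq p

/-- The Galois action on geometric points of `F_k`. -/
def Point.gal {k : ℕ} (σ : GalGroup F) : Point F k → Point F k :=
  Quotient.lift (fun v => Point.mk k (Coords.gal σ v)) (by
    rintro v w ⟨a, b, rfl⟩
    exact Quotient.sound ⟨_, _, Coords.gal_scale k σ a b w⟩)

/-- The projection `π : F_k → ℙ¹` on geometric points. -/
def Point.proj {k : ℕ} : Point F k → BasePoint F :=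
  Quotient.lift (fun v => Projectivization.mk (Geom F) v.t v.t_ne) (by
    rintro v w ⟨a, b, rfl⟩
    rw [Projectivization.mk_eq_mk_iff]
    exact ⟨a, by funext i; simp [Coords.scale, Units.smul_def]⟩)

/-! ### Markings and restriction of sections -/

/-- A `D`-marking of `F_k`: a reduced `0`-dimensional closed subscheme `𝒟 ⊆ π⁻¹(D)` such that
`π` restricts to an isomorphism `𝒟 ≅ D`. -/
structure Marking (k : ℕ) (D : ReducedDivisor F) where
  points : Set (Point F k)
  finite : points.Finite
  gal_mem : ∀ (σ : GalGroup F), ∀ p ∈ points, Point.gal σ p ∈ points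
  bijOn : Set.BijOn Point.proj points D.points

variable {k : ℕ} {D : ReducedDivisor F}

/-- `H⁰(𝒟, 𝒪_𝒟)`: the Galois-equivariant functions on the geometric points of `𝒟`. -/
def Marking.functions (M : Marking k D) : Submodule F (M.points → Geom F) where
  carrier := {f | ∀ (σ : GalGroup F) (p : M.points),
    f ⟨Point.gal σ p, M.gal_mem σ p p.2⟩ = σ (f p)}
  add_mem' := by
    intro f g hf hg σ p
    simp [hf σ p, hg σ p]
  zero_mem' := by
    intro σ p
    simp
  smul_mem' := by
    intro c f hf σ p
    simp [hf σ p]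

/-- A trivialization `𝒪_𝒟 ≅ 𝒪(m, l)|_𝒟`, that is, a nowhere vanishing section of `𝒪(m, l)|_𝒟`: a
function of the homogeneous coordinates of the geometric points of `𝒟`, of bidegree `(m, l)`,
equivariant under Galois, and nowhere zero. Values off `𝒟` play no role. -/
structure Marking.Trivialization (M : Marking k D) (m l : ℕ) where
  toFun : Coords F → Geom F
  scale : ∀ v, Point.mk k v ∈ M.points → ∀ a b : (Geom F)ˣ,
    toFun (Coords.scale k a b v) = b ^ m * a ^ l * toFun v
  gal : ∀ v, Point.mk k v ∈ M.points → ∀ σ : GalGroup F,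
    toFun (Coords.gal σ v) = σ (toFun v)
  ne_zero : ∀ v, Point.mk k v ∈ M.points → toFun v ≠ 0

/-- A leading coordinate of a vector. -/
def lead (u : Fin 2 → Geom F) : Geom F := open Classical in if u 0 = 0 then u 1 else u 0

theorem lead_ne_zero {u : Fin 2 → Geom F} (h : u ≠ 0) : lead u ≠ 0 := by
  unfold lead
  split_ifs with h0
  · intro h1
    apply h
    funext i
    fin_cases i <;> simpa
  · exact h0

/-- Every `𝒪(m, l)` can be trivialized on every marking. -/
instance (M : Marking k D) (m l : ℕ) : Nonempty (M.Trivialization m l) := by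
  -- `x` if `x ≠ 0`, and `y / (lead t)^k` otherwise
  refine ⟨⟨fun v => lead v.t ^ l * lead ![v.z 0, v.z 1 / lead v.t ^ k] ^ m, ?_, ?_, ?_⟩⟩
  · intro v _ a b
    have ht : lead (Coords.scale k a b v).t = a * lead v.t := by
      simp only [lead, Coords.scale]
      split_ifs <;> simp_all
    have hz : lead ![(Coords.scale k a b v).z 0, (Coords.scale k a b v).z 1 /
        lead (Coords.scale k a b v).t ^ k] = b * lead ![v.z 0, v.z 1 / lead v.t ^ k] := by
      rw [ht]
      have ha : (a : Geom F) ≠ 0 := a.ne_zero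
      have hl := lead_ne_zero v.t_ne
      have h1 : (b : Geom F) * a ^ k * v.z 1 / (a * lead v.t) ^ k =
          b * (v.z 1 / lead v.t ^ k) := by
        rw [mul_pow]
        field_simp
      simp [lead, Coords.scale] at h1 ⊢
      split_ifs <;> simp_all
    rw [hz, ht]
    ring
  · intro v _ σ
    have hl : ∀ u : Fin 2 → Geom F, lead (fun i => σ (u i)) = σ (lead u) := by
      intro u
      simp only [lead]
      split_ifs <;> simp_all
    have ht : lead (Coords.gal σ v).t = σ (lead v.t) := hl v.t
    have hz : lead ![(Coords.gal σ v).z 0, (Coords.gal σ v).z 1 / lead (Coords.gal σ v).t ^ k] =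
        σ (lead ![v.z 0, v.z 1 / lead v.t ^ k]) := by
      rw [ht, ← hl ![v.z 0, v.z 1 / lead v.t ^ k]]
      congr 1
      funext i
      fin_cases i <;> simp [Coords.gal]
    rw [hz, ht, map_mul, map_pow, map_pow]
  · intro v _
    have h := lead_ne_zero v.t_ne
    refine mul_ne_zero (pow_ne_zero _ h) (pow_ne_zero _ (lead_ne_zero ?_))
    intro h0
    apply v.z_ne
    funext i
    have := congrFun h0 i
    fin_cases i
    · simpa using this
    · simpa [h] using this

/-- Forms of bidegree `(m, l)` scale by `b^m a^l` under the torus. -/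
theorem aeval_scale {m l : ℕ} {s : MvPolynomial (Fin 2 ⊕ Fin 2) F}
    (hs : s ∈ globalSections F k m l) (a b : (Geom F)ˣ) (v : Coords F) :
    aeval (Coords.scale k a b v).val s = b ^ m * a ^ l * aeval v.val s := by
  have hs' : s.IsWeightedHomogeneous (bidegree k) (m, l) := hs
  rw [aeval_def, aeval_def, eval₂_eq', eval₂_eq', Finset.mul_sum]
  refine Finset.sum_congr rfl fun d hd => ?_
  have hw := hs' (mem_support_iff.mp hd)
  rw [Finsupp.weight_apply, Finsupp.sum_fintype _ _ (by simp)] at hw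
  simp only [Fintype.sum_sum_type, Fin.sum_univ_two, bidegree, Sum.elim_inl, Sum.elim_inr,
    Matrix.cons_val_zero, Matrix.cons_val_one, Prod.ext_iff, Prod.fst_add, Prod.snd_add,
    Prod.smul_fst, Prod.smul_snd, smul_eq_mul] at hw
  obtain ⟨h1, h2⟩ := hw
  simp only [Fintype.prod_sum_type, Fin.prod_univ_two, Coords.val, Coords.scale, Sum.elim_inl,
    Sum.elim_inr, Matrix.cons_val_zero, Matrix.cons_val_one, mul_pow]
  rw [← h1, ← h2]
  ring

theorem aeval_gal (s : MvPolynomial (Fin 2 ⊕ Fin 2) F) (σ : GalGroup F) (v : Coords F) :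
    aeval (Coords.gal σ v).val s = σ (aeval v.val s) := by
  have h : (Coords.gal σ v).val = fun i => σ (v.val i) := by
    funext i
    cases i <;> rfl
  rw [h]
  exact (comp_aeval_apply (v.val) (σ : Geom F →ₐ[F] Geom F) s).symm

/-- The restriction map `H⁰(F_k, 𝒪(m, l)) → H⁰(𝒟, 𝒪(m, l)|_𝒟) ≅ H⁰(𝒟, 𝒪_𝒟)`, where the second
identification is the given trivialization. The value at a point does not depend on the
coordinates chosen for it. -/
def Marking.restriction (M : Marking k D) {m l : ℕ} (τ : M.Trivialization m l) :
    globalSections F k m l →ₗ[F] M.functions where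
  toFun s := ⟨fun p => aeval (p : Point F k).rep.val (s : MvPolynomial (Fin 2 ⊕ Fin 2) F) /
      τ.toFun (p : Point F k).rep, by
    intro σ p
    have hp : Point.mk k (p : Point F k).rep ∈ M.points := by
      rw [Point.mk_rep]; exact p.2
    have hgal : Point.mk k (Coords.gal σ (p : Point F k).rep) =
        Point.gal σ (p : Point F k) := by
      conv_rhs => rw [← Point.mk_rep (p : Point F k)]
      rfl
    have hg : Point.mk k (Coords.gal σ (p : Point F k).rep) ∈ M.points := by
      rw [hgal]; exact M.gal_mem σ p p.2
    obtain ⟨a, b, hab⟩ : ∃ a b : (Geom F)ˣ, (Point.gal σ (p : Point F k)).rep =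
        Coords.scale k a b (Coords.gal σ (p : Point F k).rep) := by
      have : Point.mk k (Point.gal σ (p : Point F k)).rep =
          Point.mk k (Coords.gal σ (p : Point F k).rep) := by
        rw [Point.mk_rep, hgal]
      exact Quotient.exact this
    have hc : ((b : Geom F) ^ m * (a : Geom F) ^ l) ≠ 0 :=
      mul_ne_zero (pow_ne_zero _ b.ne_zero) (pow_ne_zero _ a.ne_zero)
    change aeval (Point.gal σ (p : Point F k)).rep.val _ / τ.toFun (Point.gal σ (p : Point F k)).rep
      = σ (_ / _)
    rw [hab, aeval_scale s.2, τ.scale _ hg, aeval_gal, τ.gal _ hp, mul_div_mul_left _ _ hc,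
      map_div₀]⟩
  map_add' s s' := by
    ext p
    simp [add_div]
  map_smul' c s := by
    ext p
    simp [Algebra.smul_def, mul_div_assoc]

end Surface

end Hirzebruch

end

/-! Put h = l - 2k. The numerical hypothesis makes dim H⁰(𝒪(1, h)) ≥ 2(h + 1) - k exceed deg D, so a
nonzero form Ax + By of bidegree (1, h) vanishes on the marking (`Marking.exists_section_eq_zero`).
Removing the common factor of the binary forms A and B (`exists_coprime_parts`) leaves an integral
curve C : ax + by = 0 of class 𝒪(1, r + k), mapped isomorphically to ℙ¹. When B = 0 the curve is x =
0, which behaves like r = -k. Marking points off C lie over zeros of the removed factor, so there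
are at most h - (r + k) = l - 3k - r of them.

The number N of marking points on C now decides between the alternatives, because 𝒪(3, l) has degree
l + 3r on C. If N > l + 3r, a section in the kernel has too many zeros on C and so vanishes on it
(`curve_dvd`, `X_dvd`). If N ≤ l + 3r, every binary form of degree l + 3r on C lifts to the surface
(`exists_eq_cubic`, where r + 3k ≤ l is needed), which separates the points on C. Multiples of ax +
by separate the few points off C, and `eq_top_of_separates` combines the two.

Separation takes place at geometric points, hence over the algebraic closure.
`Marking.eq_top_of_span_eq_top` brings surjectivity back to the base field, whose algebraic closure
is Galois because the field is perfect.

In the second alternative a nonzero kernel section is the equation of C times a section of some 𝒪(2,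
n). That cofactor has a horizontal component too, so the section is horizontally reducible
(`horizontallyReducible_of_dvd`). -/

open MvPolynomial

noncomputable section

namespace Hirzebruch

open scoped Polynomial

/-! ### Binary forms -/

section BinaryForms

variable {R A B : Type*} [CommRing R] [CommRing A] [Algebra R A] [CommRing B] [Algebra R B]

/-- The value at `(u, v)` of the binary form `∑ pⱼ uʲ vⁿ⁻ʲ` of degree `n` attached to a univariate
polynomial `p`. -/
def binForm (n : ℕ) (p : R[X]) (u v : A) : A :=
  aeval ![u, v] (p.homogenize n)

@[simp]
theorem binForm_zero (n : ℕ) (u v : A) : binForm n (0 : R[X]) u v = 0 := by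
  simp [binForm]

theorem binForm_add (n : ℕ) (p q : R[X]) (u v : A) :
    binForm n (p + q) u v = binForm n p u v + binForm n q u v := by
  simp [binForm]

theorem binForm_neg (n : ℕ) (p : R[X]) (u v : A) :
    binForm n (-p) u v = -binForm n p u v := by
  simp [binForm, Polynomial.homogenize_neg]

theorem binForm_C_mul (n : ℕ) (c : R) (p : R[X]) (u v : A) :
    binForm n (.C c * p) u v = algebraMap R A c * binForm n p u v := by
  simp [binForm]

theorem binForm_smul (n : ℕ) (c : R) (p : R[X]) (u v : A) :
    binForm n (c • p) u v = c • binForm n p u v := by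
  simp [binForm]

theorem binForm_sum {ι : Type*} (n : ℕ) (s : Finset ι) (p : ι → R[X]) (u v : A) :
    binForm n (∑ i ∈ s, p i) u v = ∑ i ∈ s, binForm n (p i) u v := by
  simp [binForm]

theorem binForm_mul {m n : ℕ} {p q : R[X]} (hp : p.natDegree ≤ m) (hq : q.natDegree ≤ n)
    (u v : A) : binForm (m + n) (p * q) u v = binForm m p u v * binForm n q u v := by
  simp [binForm, Polynomial.homogenize_mul p q hp hq]

theorem binForm_pow {n : ℕ} {p : R[X]} (hp : p.natDegree ≤ n) (m : ℕ)
    (u v : A) : binForm (m * n) (p ^ m) u v = binForm n p u v ^ m := by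
  induction m with
  | zero => simp [binForm]
  | succ m ih =>
    rw [pow_succ, pow_succ, Nat.succ_mul, binForm_mul _ hp, ih]
    exact Polynomial.natDegree_pow_le_of_le m hp

theorem binForm_X_pow {n j : ℕ} (h : j ≤ n) (u v : A) :
    binForm n (.X ^ j : R[X]) u v = u ^ j * v ^ (n - j) := by
  simp [binForm, Polynomial.homogenize_X_pow h]

theorem binForm_one (n : ℕ) (u v : A) : binForm n (1 : R[X]) u v = v ^ n := by
  simp [binForm]

theorem map_binForm (f : A →ₐ[R] B) (n : ℕ) (p : R[X]) (u v : A) :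
    f (binForm n p u v) = binForm n p (f u) (f v) := by
  rw [binForm, binForm, comp_aeval_apply]
  congr 2
  funext i
  fin_cases i <;> rfl

theorem binForm_map_algebraMap [Algebra A B] [IsScalarTower R A B] (n : ℕ) (p : R[X]) (u v : B) :
    binForm n (p.map (algebraMap R A)) u v = binForm n p u v := by
  rw [binForm, binForm, Polynomial.homogenize_map, aeval_map_algebraMap]

theorem binForm_eq_sum {n : ℕ} {p : R[X]} (hp : p.natDegree ≤ n) (u v : A) :
    binForm n p u v = ∑ j ∈ Finset.range (n + 1), p.coeff j • (u ^ j * v ^ (n - j)) := by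
  conv_lhs => rw [p.as_sum_range_C_mul_X_pow' (n := n + 1) (by omega)]
  rw [binForm_sum]
  refine Finset.sum_congr rfl fun j hj => ?_
  rw [binForm_C_mul, binForm_X_pow (by simpa [Nat.lt_succ_iff] using hj), Algebra.smul_def]

theorem binForm_apply_one {n : ℕ} {p : R[X]} (hp : p.natDegree ≤ n) (u : A) :
    binForm n p u 1 = Polynomial.aeval u p := by
  rw [binForm, Polynomial.aeval_homogenize_of_eq_one hp] <;> simp

theorem binForm_smul_smul {n : ℕ} {p : R[X]} (hp : p.natDegree ≤ n) (c u v : A) :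
    binForm n p (c * u) (c * v) = c ^ n * binForm n p u v := by
  rw [binForm_eq_sum hp, binForm_eq_sum hp, Finset.mul_sum]
  refine Finset.sum_congr rfl fun j hj => ?_
  rw [mul_smul_comm]
  congr 1
  have : n = j + (n - j) := by simp at hj; omega
  conv_rhs => rw [this]
  rw [add_tsub_cancel_left]
  ring

theorem binForm_apply_zero {n : ℕ} {p : R[X]} (hp : p.natDegree ≤ n) (u : A) :
    binForm n p u 0 = p.coeff n • u ^ n := by
  rw [binForm_eq_sum hp, Finset.sum_eq_single n]
  · simp
  · intro j hj hjn
    have : n - j ≠ 0 := by simp at hj; omega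
    simp [this]
  · simp

end BinaryForms

/-! ### Zeros, interpolation and coprimality of binary forms over a field -/

section BinaryFormsField

variable {F K : Type*} [Field F] [Field K] [Algebra F K]

/-- A nonzero binary form of degree `n` has at most `n` zeros on the projective line. -/
theorem card_le_of_binForm_eq_zero {ι : Type*} (T : Finset ι) (t : ι → Fin 2 → K)
    (t_ne : ∀ i, t i ≠ 0)
    (ht : ∀ i j, i ≠ j → t i 0 * t j 1 ≠ t i 1 * t j 0) {n : ℕ} {p : F[X]}
    (hp : p.natDegree ≤ n) (h0 : p ≠ 0)
    (hT : ∀ i ∈ T, binForm n p (t i 0) (t i 1) = 0) : T.card ≤ n := by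
  classical
  set q : K[X] := p.map (algebraMap F K) with hq
  have hq0 : q ≠ 0 := by simpa [hq] using h0
  have hqn : q.natDegree = p.natDegree := by simp [hq]
  -- Zeros other than [1 : 0] are roots of the dehomogenised polynomial.
  have key : ∀ i ∈ T, t i 1 ≠ 0 → t i 0 / t i 1 ∈ q.roots.toFinset := by
    intro i hi h1
    rw [Multiset.mem_toFinset, Polynomial.mem_roots hq0, Polynomial.IsRoot.def,
      hq, Polynomial.eval_map_algebraMap, ← binForm_apply_one hp]
    have := hT i hi
    have e : t i 0 = t i 1 * (t i 0 / t i 1) := by field_simp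
    rw [e, ← mul_one (t i 1), mul_assoc, one_mul, binForm_smul_smul hp] at this
    simpa [h1] using this
  have hinj : Set.InjOn (fun i => t i 0 / t i 1) (T.filter fun i => t i 1 ≠ 0 : Finset ι) := by
    intro i hi j hj hij
    by_contra hne
    simp only [Finset.coe_filter, Set.mem_ofPred_eq] at hi hj
    have hi2 := hi.2
    have hj2 := hj.2
    apply ht i j hne
    simp only at hij
    field_simp at hij
    linear_combination hij
  have hc1 : (T.filter fun i => t i 1 ≠ 0).card ≤ p.natDegree := by
    rw [← Finset.card_image_of_injOn hinj]
    calc _ ≤ q.roots.toFinset.card := by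
          apply Finset.card_le_card
          intro x hx
          simp only [Finset.mem_image, Finset.mem_filter] at hx
          obtain ⟨i, ⟨hi, h1⟩, rfl⟩ := hx
          exact key i hi h1
      _ ≤ q.roots.card := Multiset.toFinset_card_le _
      _ ≤ _ := hqn ▸ q.card_roots'
  -- Only [1 : 0] can occur here. Vanishing there kills the coefficient of degree n, so the degree
  -- drops by at least one and leaves room for this zero.
  have hc2 : (T.filter fun i => ¬ t i 1 ≠ 0).card ≤ n - p.natDegree := by
    rcases (T.filter fun i => ¬ t i 1 ≠ 0).eq_empty_or_nonempty with he | ⟨i, hi⟩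
    · rw [he, Finset.card_empty]
      exact Nat.zero_le _
    · have h1 : (T.filter fun i => ¬ t i 1 ≠ 0).card ≤ 1 := by
        rw [Finset.card_le_one]
        intro i hi j hj
        by_contra hne
        simp only [Finset.mem_filter, not_not] at hi hj
        apply ht i j hne
        simp [hi.2, hj.2]
      simp only [Finset.mem_filter, not_not] at hi
      have h2 := hT i hi.1
      have hi0 : t i 0 ≠ 0 := by
        intro h
        apply t_ne i
        funext j
        fin_cases j
        · exact h
        · exact hi.2
      rw [hi.2, binForm_apply_zero hp] at h2
      have h3 : p.coeff n = 0 := by simpa [hi0, Algebra.smul_def] using h2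
      have : p.natDegree ≠ n := by
        rintro rfl
        simp [h0] at h3
      omega
  have := Finset.card_filter_add_card_filter_not (s := T) (fun i => t i 1 ≠ 0)
  omega

/-- There are forms of degree at least `#T` vanishing on `T` but not at a further point. -/
theorem exists_binForm_ne_zero {ι : Type*} (T : Finset ι) (t : ι → Fin 2 → K)
    (ht : ∀ i j, i ≠ j → t i 0 * t j 1 ≠ t i 1 * t j 0) (i : ι) (hi : i ∉ T) (t_ne : t i ≠ 0)
    {n : ℕ} (hn : T.card ≤ n) :
    ∃ p : K[X], p.natDegree ≤ n ∧ (∀ j ∈ T, binForm n p (t j 0) (t j 1) = 0) ∧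
      binForm n p (t i 0) (t i 1) ≠ 0 := by
  classical
  induction T using Finset.induction_on generalizing n with
  | empty =>
    by_cases h1 : t i 1 = 0
    · have h0 : t i 0 ≠ 0 := by
        intro h
        apply t_ne
        funext j
        fin_cases j
        · exact h
        · exact h1
      refine ⟨.X ^ n, by simp, by simp, ?_⟩
      rw [binForm_X_pow le_rfl]
      simp [h0]
    · exact ⟨1, by simp, by simp, by simp [binForm_one, h1]⟩
  | insert a T ha ih =>
    rw [Finset.card_insert_of_notMem ha] at hn
    rw [Finset.mem_insert, not_or] at hi
    obtain ⟨m, rfl⟩ : ∃ m, n = m + 1 := ⟨n - 1, by omega⟩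
    obtain ⟨p, hp, hp0, hpi⟩ := ih hi.2 (n := m) (by omega)
    -- The linear form whose only zero is the new point a.
    have hl : (Polynomial.C (t a 1) * .X - .C (t a 0) : K[X]).natDegree ≤ 1 := by
      compute_degree
    have hlv : ∀ u v : K, binForm 1 (Polynomial.C (t a 1) * .X - .C (t a 0) : K[X]) u v =
        t a 1 * u - t a 0 * v := by
      intro u v
      simp [binForm, Polynomial.homogenize_sub]
    refine ⟨p * (.C (t a 1) * .X - .C (t a 0)), ?_, ?_, ?_⟩
    · exact (Polynomial.natDegree_mul_le_of_le hp hl)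
    · intro j hj
      rw [binForm_mul hp hl, hlv]
      rw [Finset.mem_insert] at hj
      rcases hj with rfl | hj
      · ring
      · rw [hp0 j hj, zero_mul]
    · rw [binForm_mul hp hl, hlv]
      refine mul_ne_zero hpi ?_
      have := ht i a hi.1
      contrapose! this
      linear_combination this

/-- If binary forms `a` and `b` of degrees `p` and `r` have no common zero, then every form of
degree `n ≥ p + r - 1` is a combination of them. -/
theorem exists_eq_mul_add_mul {a b : F[X]} (hab : IsCoprime a b) {p r n : ℕ}
    (ha : a.natDegree ≤ p) (hb : b.natDegree ≤ r) (hpr : a.degree = p ∨ b.degree = r)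
    (hn : p + r ≤ n + 1) {G : F[X]} (hG : G.natDegree ≤ n) :
    ∃ u v : F[X], G = u * a + v * b ∧ u.natDegree ≤ n - p ∧ v.natDegree ≤ n - r := by
  wlog h : b.degree = r generalizing a b p r
  · have h' := hpr.resolve_right h
    obtain ⟨u, v, h1, h2, h3⟩ := this hab.symm hb ha (Or.inr h') (by omega) h'
    exact ⟨v, u, by rw [h1]; ring, h3, h2⟩
  have b0 : b ≠ 0 := by
    rintro rfl
    simp at h
  replace h := Polynomial.natDegree_eq_of_degree_eq_some h
  obtain ⟨x, y, hxy⟩ := hab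
  -- Reducing the Bézout coefficient of a modulo b bounds its degree by r - 1. This uses that b has
  -- degree exactly r.
  set u := (G * x) % b with hu
  have hdiv := EuclideanDomain.div_add_mod (G * x) b
  have hGe : G = u * a + (G * y + (G * x / b) * a) * b := by
    rw [hu]
    linear_combination (-G) * hxy - a * hdiv
  set v := G * y + (G * x / b) * a with hv
  have hud : u = 0 ∨ (u.natDegree < r ∧ 0 < r) := by
    by_cases hr : r = 0
    · left
      rw [hr, Polynomial.natDegree_eq_zero] at h
      obtain ⟨c, rfl⟩ := h
      rw [hu, EuclideanDomain.mod_eq_zero]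
      · apply IsUnit.dvd
        simpa using b0
    · right
      refine ⟨?_, by omega⟩
      rw [← h]
      exact Polynomial.natDegree_mod_lt _ (by omega)
  -- The other term is G - ua, of degree at most max(n, r - 1 + p) = n; this is where p + r ≤ n + 1
  -- enters.
  have hvb : (v * b).natDegree ≤ n := by
    have : v * b = G - u * a := by rw [hGe]; ring
    rw [this]
    refine (Polynomial.natDegree_sub_le_of_le hG ?_).trans (max_self n).le
    rcases hud with h0 | ⟨h1, h2⟩
    · simp [h0]
    · refine (Polynomial.natDegree_mul_le_of_le (m := r - 1) (n := p) (by omega) ha).trans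
        (by omega)
  refine ⟨u, v, hGe, ?_, ?_⟩
  · rcases hud with h0 | ⟨h1, h2⟩
    · simp [h0]
    · omega
  · by_cases v0 : v = 0
    · simp [v0]
    · rw [Polynomial.natDegree_mul v0 b0] at hvb
      omega

/-- If binary forms `a` and `b` of degrees `p` and `r` have no common zero, then the ideal they
generate contains a power of the irrelevant ideal. -/
theorem dvd_pow_of_dvd_binForm {A : Type*} [CommRing A] [Algebra F A] {a b : F[X]}
    (hab : IsCoprime a b) {p r : ℕ} (ha : a.natDegree ≤ p) (hb : b.natDegree ≤ r)
    (hpr : a.degree = p ∨ b.degree = r) {u v d : A} (hda : d ∣ binForm p a u v)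
    (hdb : d ∣ binForm r b u v) : d ∣ u ^ (p + r + 1) ∧ d ∣ v ^ (p + r + 1) := by
  have key : ∀ G : F[X], G.natDegree ≤ p + r + 1 → d ∣ binForm (p + r + 1) G u v := by
    intro G hG
    obtain ⟨x, y, h1, h2, h3⟩ := exists_eq_mul_add_mul hab ha hb hpr (by omega) hG
    rw [h1, binForm_add]
    refine dvd_add ?_ ?_
    · have e : p + r + 1 = p + r + 1 - p + p := by omega
      rw [e, binForm_mul h2 ha]
      exact hda.mul_left _
    · have e : p + r + 1 = p + r + 1 - r + r := by omega
      rw [e, binForm_mul h3 hb]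
      exact hdb.mul_left _
  constructor
  · have := key (.X ^ (p + r + 1)) (by simp)
    rwa [binForm_X_pow le_rfl, Nat.sub_self, pow_zero, mul_one] at this
  · have := key 1 (by simp)
    rwa [binForm_one] at this

/-- If binary forms `a` and `b` of degrees `r + k` and `r` have no common zero and `l ≥ r + 3 k`, then
every form of degree `l + 3 r` is the restriction of a section of `𝒪(3, l)` to the curve `a x + b y = 0`. -/
theorem exists_eq_cubic {a b : F[X]} (hab : IsCoprime a b) {k r l : ℕ}
    (ha : a.natDegree ≤ r + k) (hb : b.natDegree ≤ r)
    (hpr : a.degree = (r + k : ℕ) ∨ b.degree = r) (hl : r + 3 * k ≤ l) {G : F[X]}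
    (hG : G.natDegree ≤ l + 3 * r) :
    ∃ A : ℕ → F[X], (∀ i, (A i).natDegree ≤ l - i * k) ∧
      G = ∑ i ∈ Finset.range 4, A i * (b ^ (3 - i) * (-a) ^ i) := by
  -- Splitting three times along a and b gives a cubic expression in a and b; the mixed terms are
  -- merged before each new split. The tightest split is that of the coefficient of a², of degree l
  -- + r - 2k, which needs r + 3k ≤ l + 1.
  obtain ⟨u, v, h, hu, hv⟩ := exists_eq_mul_add_mul hab ha hb hpr (by omega) hG
  obtain ⟨u₁, u₂, h₁, hu₁, hu₂⟩ := exists_eq_mul_add_mul hab ha hb hpr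
    (n := l + 2 * r - k) (by omega) (hu.trans (by omega))
  obtain ⟨v₁, v₂, h₂, hv₁, hv₂⟩ := exists_eq_mul_add_mul hab ha hb hpr
    (n := l + 2 * r) (by omega) (hv.trans (by omega))
  have hw : (u₂ + v₁).natDegree ≤ l + r - k :=
    (Polynomial.natDegree_add_le_of_le hu₂ hv₁).trans (by omega)
  obtain ⟨p₁, p₂, h₃, hp₁, hp₂⟩ := exists_eq_mul_add_mul hab ha hb hpr
    (n := l + r - 2 * k) (by omega) (hu₁.trans (by omega))
  obtain ⟨q₁, q₂, h₄, hq₁, hq₂⟩ := exists_eq_mul_add_mul hab ha hb hpr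
    (n := l + r - k) (by omega) hw
  obtain ⟨s₁, s₂, h₅, hs₁, hs₂⟩ := exists_eq_mul_add_mul hab ha hb hpr
    (n := l + r) (by omega) (hv₂.trans (by omega))
  refine ⟨fun i => if i = 0 then s₂ else if i = 1 then -(q₂ + s₁) else if i = 2 then p₂ + q₁ else
    if i = 3 then -p₁ else 0, ?_, ?_⟩
  · intro i
    rcases i with _ | _ | _ | _ | i
    · simp only [if_true]
      omega
    · simp only [zero_add, one_ne_zero, if_false, if_true, Polynomial.natDegree_neg]
      exact (Polynomial.natDegree_add_le_of_le hq₂ hs₁).trans (by omega)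
    · simp only [zero_add, Nat.reduceAdd, OfNat.ofNat_ne_zero, OfNat.ofNat_ne_one, if_false, if_true]
      exact (Polynomial.natDegree_add_le_of_le hp₂ hq₁).trans (by omega)
    · simp only [zero_add, Nat.reduceAdd, OfNat.ofNat_ne_zero, OfNat.ofNat_ne_one, if_false,
        Nat.reduceEqDiff, if_true, Polynomial.natDegree_neg]
      omega
    · simp
  · simp [Finset.sum_range_succ]
    linear_combination h + a * h₁ + b * h₂ + a ^ 2 * h₃ + a * b * h₄ + b ^ 2 * h₅

end BinaryFormsField

/-! ### Factors of bihomogeneous forms -/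

section Factors

variable {F : Type*} [Field F] {ι : Type*}

/-- The grading of a polynomial ring by `w`, encoded by a new variable. -/
def gradingHom (F : Type*) [Field F] (w : ι → ℕ) :
    MvPolynomial ι F →ₐ[F] (MvPolynomial ι F)[X] :=
  aeval fun i => Polynomial.C (X i) * Polynomial.X ^ w i

theorem gradingHom_monomial (w : ι → ℕ) (d : ι →₀ ℕ) (c : F) :
    gradingHom F w (monomial d c) =
      Polynomial.C (monomial d c) * Polynomial.X ^ Finsupp.weight w d := by
  rw [gradingHom, aeval_monomial, monomial_eq (s := d), Finsupp.weight_apply]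
  simp only [Finsupp.prod, Finsupp.sum, mul_pow, Finset.prod_mul_distrib, map_mul, map_prod,
    map_pow, ← pow_mul, Finset.prod_pow_eq_pow_sum, smul_eq_mul, mul_comm (w _)]
  rw [← mul_assoc]
  rfl

theorem coeff_gradingHom (w : ι → ℕ) (p : MvPolynomial ι F) (j : ℕ) :
    (gradingHom F w p).coeff j = weightedHomogeneousComponent w j p := by
  classical
  induction p using MvPolynomial.induction_on' with
  | add p q hp hq => simp [hp, hq]
  | monomial d c =>
    rw [gradingHom_monomial, Polynomial.coeff_C_mul_X_pow]
    have h := isWeightedHomogeneous_monomial w d c (m := Finsupp.weight w d) rfl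
    rw [weightedHomogeneousComponent_of_mem (m := j) h]

/-- In the auxiliary variable, pq becomes a single monomial. Degree and trailing degree are both
additive on products, so they must agree on each factor as well. -/
theorem exists_isWeightedHomogeneous_of_mul {w : ι → ℕ} {p q : MvPolynomial ι F} {n : ℕ}
    (h : IsWeightedHomogeneous w (p * q) n) (h0 : p * q ≠ 0) :
    ∃ i, IsWeightedHomogeneous w p i := by
  classical
  have inj : ∀ r : MvPolynomial ι F, gradingHom F w r = 0 → r = 0 := by
    intro r hr
    ext d
    have := coeff_gradingHom w r (Finsupp.weight w d)
    rw [hr, Polynomial.coeff_zero] at this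
    have h2 := congrArg (coeff d) this
    rw [coeff_weightedHomogeneousComponent, if_pos rfl] at h2
    simpa using h2.symm
  have hprod : gradingHom F w p * gradingHom F w q = Polynomial.monomial n (p * q) := by
    rw [← map_mul]
    ext1 j
    rw [coeff_gradingHom, weightedHomogeneousComponent_of_mem (m := j) h,
      Polynomial.coeff_monomial]
    simp [eq_comm]
  have hp0 : gradingHom F w p ≠ 0 := fun hp => by simp [inj p hp] at h0
  have hq0 : gradingHom F w q ≠ 0 := fun hp => by simp [inj q hp] at h0
  have h1 := Polynomial.natDegree_mul hp0 hq0
  have h2 := Polynomial.natTrailingDegree_mul hp0 hq0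
  rw [hprod, Polynomial.natDegree_monomial_eq _ h0] at h1
  rw [hprod, Polynomial.natTrailingDegree_monomial h0] at h2
  have h3 := Polynomial.natTrailingDegree_le_natDegree (gradingHom F w p)
  have h4 := Polynomial.natTrailingDegree_le_natDegree (gradingHom F w q)
  refine ⟨(gradingHom F w p).natDegree, fun d hd => ?_⟩
  have h5 : (gradingHom F w p).coeff (Finsupp.weight w d) ≠ 0 := by
    rw [coeff_gradingHom]
    intro h6
    have h7 := congrArg (coeff d) h6
    rw [coeff_weightedHomogeneousComponent, if_pos rfl] at h7
    exact hd (by simpa using h7)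
  have h6 := Polynomial.le_natDegree_of_ne_zero h5
  have h7 := Polynomial.natTrailingDegree_le_of_ne_zero h5
  omega

theorem mem_globalSections_iff {k m n : ℕ} {p : MvPolynomial (Fin 2 ⊕ Fin 2) F} :
    p ∈ globalSections F k m n ↔
      IsWeightedHomogeneous (fun i => (bidegree k i).1) p m ∧
        IsWeightedHomogeneous (fun i => (bidegree k i).2) p n := by
  have hw : ∀ d : Fin 2 ⊕ Fin 2 →₀ ℕ, Finsupp.weight (bidegree k) d =
      (Finsupp.weight (fun i => (bidegree k i).1) d,
        Finsupp.weight (fun i => (bidegree k i).2) d) := by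
    intro d
    simp only [Finsupp.weight_apply, Finsupp.sum]
    ext
    · simp [Prod.fst_sum]
    · simp [Prod.snd_sum]
  rw [mem_weightedHomogeneousSubmodule]
  constructor
  · intro h
    refine ⟨fun d hd => ?_, fun d hd => ?_⟩
    · have := h hd
      rw [hw] at this
      exact congrArg Prod.fst this
    · have := h hd
      rw [hw] at this
      exact congrArg Prod.snd this
  · rintro ⟨h1, h2⟩ d hd
    rw [hw, h1 hd, h2 hd]

theorem exists_mem_globalSections_of_mul {k m n : ℕ} {p q : MvPolynomial (Fin 2 ⊕ Fin 2) F}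
    (h : p * q ∈ globalSections F k m n) (h0 : p * q ≠ 0) :
    ∃ m₁ n₁ m₂ n₂, p ∈ globalSections F k m₁ n₁ ∧ q ∈ globalSections F k m₂ n₂ ∧
      m₁ + m₂ = m ∧ n₁ + n₂ = n := by
  obtain ⟨h1, h2⟩ := mem_globalSections_iff.1 h
  obtain ⟨m₁, hm₁⟩ := exists_isWeightedHomogeneous_of_mul h1 h0
  obtain ⟨n₁, hn₁⟩ := exists_isWeightedHomogeneous_of_mul h2 h0
  rw [mul_comm] at h1 h2
  obtain ⟨m₂, hm₂⟩ := exists_isWeightedHomogeneous_of_mul h1 (by rwa [mul_comm])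
  obtain ⟨n₂, hn₂⟩ := exists_isWeightedHomogeneous_of_mul h2 (by rwa [mul_comm])
  rw [mul_comm] at h1 h2
  exact ⟨m₁, n₁, m₂, n₂, mem_globalSections_iff.2 ⟨hm₁, hn₁⟩, mem_globalSections_iff.2 ⟨hm₂, hn₂⟩,
    (hm₁.mul hm₂).inj_right h0 h1, (hn₁.mul hn₂).inj_right h0 h2⟩

theorem bidegree_unique {k m n m' n' : ℕ} {p : MvPolynomial (Fin 2 ⊕ Fin 2) F} (h0 : p ≠ 0)
    (h : p ∈ globalSections F k m n) (h' : p ∈ globalSections F k m' n') : m = m' ∧ n = n' := by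
  have := IsWeightedHomogeneous.inj_right h0 h h'
  simpa using this

/-- A nonzero section of `𝒪(m, n)` with `m > 0` vanishes on a horizontal curve. -/
theorem exists_isHorizontalCurve_dvd {k : ℕ} (s : MvPolynomial (Fin 2 ⊕ Fin 2) F) (h0 : s ≠ 0)
    {m n : ℕ} (hm : 0 < m) (hs : s ∈ globalSections F k m n) :
    ∃ q, IsHorizontalCurve k q ∧ q ∣ s := by
  induction s using UniqueFactorizationMonoid.induction_on_prime generalizing m n with
  | h₁ => exact absurd rfl h0
  | h₂ x hx =>
    obtain ⟨c, -, rfl⟩ := MvPolynomial.isUnit_iff_eq_C_of_isReduced.1 hx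
    have hC : (C c : MvPolynomial (Fin 2 ⊕ Fin 2) F) ∈ globalSections F k 0 0 :=
      isWeightedHomogeneous_C _ c
    have := bidegree_unique h0 hs hC
    omega
  | h₃ a p ha hp ih =>
    obtain ⟨m₁, n₁, m₂, n₂, h1, h2, h3, -⟩ := exists_mem_globalSections_of_mul hs h0
    rcases Nat.eq_zero_or_pos m₁ with hm₁ | hm₁
    · obtain ⟨q, hq, hqa⟩ := ih ha (m := m₂) (by omega) h2
      exact ⟨q, hq, hqa.mul_left p⟩
    · exact ⟨p, ⟨m₁, n₁, hm₁, h1, hp.irreducible⟩, dvd_mul_right p a⟩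

/-- A section of `𝒪(m, n)` with `m ≥ 2` vanishing on a curve of class `𝒪(1, h)` is horizontally
reducible. -/
theorem horizontallyReducible_of_dvd {k m n h : ℕ} (hm : 2 ≤ m)
    {s c : MvPolynomial (Fin 2 ⊕ Fin 2) F} (hs : s ∈ globalSections F k m n)
    (hc : IsIntegralCurve k 1 h c) (hcs : c ∣ s) : HorizontallyReducible k s := by
  rintro ⟨h0, p, hp, hps, hpp, huniq⟩
  obtain ⟨s', rfl⟩ := hcs
  obtain ⟨m₁, n₁, m₂, n₂, h1, h2, h3, -⟩ := exists_mem_globalSections_of_mul hs h0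
  have := bidegree_unique hc.2.ne_zero h1 hc.1
  -- The cofactor has fibre degree m - 1 ≥ 1, hence its own horizontal component. Uniqueness
  -- identifies it with c up to a unit, contradicting multiplicity one.
  obtain ⟨q, hq, hqs⟩ := exists_isHorizontalCurve_dvd s' (right_ne_zero_of_mul h0)
    (m := m₂) (by omega) h2
  have a1 := huniq c ⟨1, h, one_pos, hc⟩ (dvd_mul_right _ _)
  have a2 := huniq q hq (hqs.mul_left c)
  exact hpp (by rw [pow_two]; exact mul_dvd_mul a1.dvd (a2.dvd.trans hqs))

end Factors

/-! ### Galois descent -/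

section Descent

variable {F : Type*} [Field F] {k : ℕ} {D : ReducedDivisor F} (M : Marking k D)

theorem Point.gal_gal_inv (σ : GalGroup F) (p : Point F k) :
    Point.gal σ (Point.gal σ⁻¹ p) = p := by
  induction p using Quotient.inductionOn with
  | h v =>
    change Point.mk k (Coords.gal σ (Coords.gal σ⁻¹ v)) = Point.mk k v
    congr 1
    ext i
    · exact σ.apply_symm_apply _
    · exact σ.apply_symm_apply _

/-- Equivariant functions on a marking that are linearly independent over the base field are
linearly independent over its algebraic closure. -/
theorem Marking.linearIndependent_coe [PerfectField F] {J : Type*} {v : J → M.functions}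
    (hv : LinearIndependent F v) :
    LinearIndependent (Geom F) fun j => (v j : M.points → Geom F) := by
  classical
  -- Conjugating a relation gives a relation: by equivariance its value at p is σ of the original
  -- relation at σ⁻¹ p.
  have hrel : ∀ l : J →₀ Geom F, ∀ σ : GalGroup F,
      Finsupp.linearCombination (Geom F) (fun j => (v j : M.points → Geom F)) l = 0 →
      Finsupp.linearCombination (Geom F) (fun j => (v j : M.points → Geom F))
        (l.mapRange σ (map_zero σ)) = 0 := by
    intro l σ hl
    funext p
    set p' : M.points := ⟨Point.gal σ⁻¹ p, M.gal_mem σ⁻¹ p p.2⟩ with hp'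
    have hpp : (⟨Point.gal σ p', M.gal_mem σ p' p'.2⟩ : M.points) = p :=
      Subtype.ext (Point.gal_gal_inv σ _)
    have h1 := congrArg σ (congrFun hl p')
    rw [Finsupp.linearCombination_apply, Finsupp.sum, Finset.sum_apply, map_sum] at h1
    rw [Finsupp.linearCombination_apply, Finsupp.sum_mapRange_index (by simp), Finsupp.sum,
      Finset.sum_apply]
    simp only [Pi.smul_apply, smul_eq_mul, map_mul, Pi.zero_apply, map_zero] at h1 ⊢
    rw [← h1]
    refine Finset.sum_congr rfl fun j _ => ?_
    rw [← (v j).2 σ p', hpp]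
  rw [linearIndependent_iff]
  intro l
  -- Artin's argument: in a shortest relation with one coefficient normalised to 1, subtracting a
  -- conjugate shortens it, so all coefficients are Galois-fixed and lie in `F`.
  induction hn : l.support.card using Nat.strong_induction_on generalizing l with
  | _ n ih =>
    intro hl
    by_contra hl0
    obtain ⟨j₀, hj₀⟩ := Finsupp.ne_iff.1 hl0
    rw [Finsupp.zero_apply] at hj₀
    set m : J →₀ Geom F := (l j₀)⁻¹ • l with hm
    have hml : m.support = l.support := Finsupp.support_smul_eq (inv_ne_zero hj₀)
    have hm0 : m j₀ = 1 := by simp [hm, hj₀]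
    have hmrel : Finsupp.linearCombination (Geom F) (fun j => (v j : M.points → Geom F)) m = 0 := by
      rw [hm, map_smul, hl, smul_zero]
    have hfix : ∀ j (σ : GalGroup F), σ (m j) = m j := by
      intro j σ
      have h1 : m.mapRange σ (map_zero σ) - m = 0 := by
        refine ih _ ?_ _ rfl (by rw [map_sub, hrel m σ hmrel, hmrel, sub_zero])
        rw [← hn, ← hml]
        apply Finset.card_lt_card
        rw [Finset.ssubset_iff_of_subset]
        · exact ⟨j₀, by simp [hm0], by simp [hm0]⟩
        · intro i hi
          rw [Finsupp.mem_support_iff] at hi ⊢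
          contrapose! hi
          simp [hi]
      have h2 := DFunLike.congr_fun h1 j
      simpa [sub_eq_zero] using h2
    have hF : ∀ j, ∃ c : F, algebraMap F (Geom F) c = m j := by
      intro j
      have := (InfiniteGalois.mem_bot_iff_fixed (k := F) (m j)).2 (fun σ => hfix j σ)
      exact IntermediateField.mem_bot.1 this
    choose c hc using hF
    have hsum : ∑ j ∈ m.support, c j • v j = 0 := by
      ext p
      have h1 := congrFun hmrel p
      rw [Finsupp.linearCombination_apply, Finsupp.sum, Finset.sum_apply] at h1
      simp only [Pi.smul_apply, smul_eq_mul, Pi.zero_apply] at h1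
      rw [Submodule.coe_sum, Finset.sum_apply]
      simp only [Submodule.coe_smul, Pi.smul_apply, Algebra.smul_def, hc, h1]
      rfl
    have h2 := linearIndependent_iff'.1 hv _ _ hsum j₀ (by simp [hm0])
    have h3 := hc j₀
    rw [h2, hm0, map_zero] at h3
    exact zero_ne_one h3

instance (M : Marking k D) : Finite M.points := M.finite

theorem Marking.finite_functions [PerfectField F] : Module.Finite F M.functions := by
  have h := M.linearIndependent_coe (Module.Free.chooseBasis F M.functions).linearIndependent
  have := h.finite
  exact Module.Finite.of_basis (Module.Free.chooseBasis F M.functions)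

/-- A basis over `F` remains independent among all functions on the geometric points, a space of
dimension the number of points. -/
theorem Marking.finrank_functions_le [PerfectField F] :
    Module.finrank F M.functions ≤ Nat.card M.points := by
  have := M.finite_functions
  have := Fintype.ofFinite M.points
  have h := (M.linearIndependent_coe
    (Module.finBasis F M.functions).linearIndependent).fintype_card_le_finrank
  simpa using h

/-- A space of equivariant functions that spans all functions over the algebraic closure is the
space of all equivariant functions. -/
theorem Marking.eq_top_of_span_eq_top [PerfectField F] (V : Submodule F M.functions)
    (h : Submodule.span (Geom F) ((fun f : M.functions => (f : M.points → Geom F)) '' V) = ⊤) :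
    V = ⊤ := by
  have := M.finite_functions
  have := Fintype.ofFinite M.points
  apply Submodule.eq_top_of_finrank_eq
  apply le_antisymm (Submodule.finrank_le V)
  refine M.finrank_functions_le.trans ?_
  have : Module.Free F V := Module.Free.of_divisionRing F V
  let b := Module.finBasis F V
  have hb : Submodule.span (Geom F) (Set.range fun i => ((b i : M.functions) : M.points → Geom F))
      = ⊤ := by
    rw [eq_top_iff, ← h, Submodule.span_le]
    rintro _ ⟨f, hf, rfl⟩
    have h1 := congrArg (fun x : V => ((x : M.functions) : M.points → Geom F)) (b.sum_repr ⟨f, hf⟩)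
    simp only [SetLike.mem_coe] at h1 ⊢
    rw [← h1]
    simp only [Submodule.coe_sum, Submodule.coe_smul]
    refine Submodule.sum_mem _ fun i _ => ?_
    rw [← algebraMap_smul (Geom F)]
    exact Submodule.smul_mem _ _ (Submodule.subset_span ⟨i, rfl⟩)
  have h2 := finrank_range_le_card (R := Geom F)
    fun i => ((b i : M.functions) : M.points → Geom F)
  rw [Set.finrank, hb, finrank_top] at h2
  simpa using h2

theorem Marking.card_points : Nat.card M.points = D.degree :=
  Nat.card_congr (M.bijOn.equiv _)

end Descent

/-! ### Sections in terms of binary forms -/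

section Sections

variable {F : Type*} [Field F]

/-- The form of degree `n` in the coordinates `t₀, t₁` of the base attached to a univariate
polynomial. -/
def baseForm (n : ℕ) (p : F[X]) : MvPolynomial (Fin 2 ⊕ Fin 2) F :=
  binForm n p (X (Sum.inl 0)) (X (Sum.inl 1))

theorem baseForm_zero (n : ℕ) : baseForm n (0 : F[X]) = 0 := binForm_zero _ _ _

theorem baseForm_add (n : ℕ) (p q : F[X]) : baseForm n (p + q) = baseForm n p + baseForm n q :=
  binForm_add _ _ _ _ _

theorem baseForm_C_mul_X_pow {n j : ℕ} (h : j ≤ n) (c : F) :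
    baseForm n (.C c * .X ^ j) = C c * (X (Sum.inl 0) ^ j * X (Sum.inl 1) ^ (n - j)) := by
  rw [baseForm, binForm_C_mul, binForm_X_pow h]
  rfl

theorem baseForm_eq_rename (n : ℕ) (p : F[X]) :
    baseForm n p = rename Sum.inl (p.homogenize n) := by
  rw [baseForm, binForm, rename_eq_aeval]
  congr 2
  funext i
  fin_cases i <;> rfl

theorem baseForm_ne_zero {n : ℕ} {p : F[X]} (hp : p.natDegree ≤ n) (h0 : p ≠ 0) :
    baseForm n p ≠ 0 := by
  rw [baseForm_eq_rename, Ne, ← map_zero (rename Sum.inl),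
    (rename_injective _ Sum.inl_injective).eq_iff, Polynomial.homogenize_eq_zero_iff hp]
  exact h0

theorem inr_notMem_vars_baseForm (n : ℕ) (p : F[X]) (i : Fin 2) :
    Sum.inr i ∉ (baseForm n p).vars := by
  classical
  rw [baseForm_eq_rename]
  intro h
  obtain ⟨j, -, hj⟩ := Finset.mem_image.1 (vars_rename _ _ h)
  simp at hj

theorem X_mem_globalSections (k : ℕ) (i : Fin 2 ⊕ Fin 2) :
    (X i : MvPolynomial (Fin 2 ⊕ Fin 2) F) ∈
      globalSections F k (bidegree k i).1 (bidegree k i).2 :=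
  isWeightedHomogeneous_X _ _ _

theorem mul_mem_globalSections {k m n m' n' : ℕ} {p q : MvPolynomial (Fin 2 ⊕ Fin 2) F}
    (hp : p ∈ globalSections F k m n) (hq : q ∈ globalSections F k m' n') :
    p * q ∈ globalSections F k (m + m') (n + n') :=
  IsWeightedHomogeneous.mul hp hq

theorem pow_mem_globalSections {k m n : ℕ} {p : MvPolynomial (Fin 2 ⊕ Fin 2) F}
    (hp : p ∈ globalSections F k m n) (j : ℕ) :
    p ^ j ∈ globalSections F k (j * m) (j * n) := by
  have := IsWeightedHomogeneous.pow hp j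
  simpa using this

theorem baseForm_mem (k : ℕ) {n : ℕ} {p : F[X]} (hp : p.natDegree ≤ n) :
    baseForm n p ∈ globalSections F k 0 n := by
  rw [baseForm, binForm_eq_sum hp]
  refine Submodule.sum_mem _ fun j hj => Submodule.smul_mem _ _ ?_
  have := mul_mem_globalSections
    (pow_mem_globalSections (X_mem_globalSections (F := F) k (Sum.inl 0)) j)
    (pow_mem_globalSections (X_mem_globalSections (F := F) k (Sum.inl 1)) (n - j))
  convert this using 1
  have : j ≤ n := by simpa [Nat.lt_succ_iff] using hj
  simp [bidegree, this]

theorem baseForm_mul_pow_mem {k l m i : ℕ} (him : i ≤ m) (hi : i * k ≤ l) {p : F[X]}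
    (hp : p.natDegree ≤ l - i * k) :
    baseForm (l - i * k) p * (X (Sum.inr 0) ^ (m - i) * X (Sum.inr 1) ^ i) ∈
      globalSections F k m l := by
  have := mul_mem_globalSections (baseForm_mem k hp) (mul_mem_globalSections
    (pow_mem_globalSections (X_mem_globalSections (F := F) k (Sum.inr 0)) (m - i))
    (pow_mem_globalSections (X_mem_globalSections (F := F) k (Sum.inr 1)) i))
  simpa [bidegree, him, hi] using this

theorem aeval_baseForm (v : Coords F) (n : ℕ) (p : F[X]) :
    aeval v.val (baseForm n p) = binForm n p (v.t 0) (v.t 1) := by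
  rw [baseForm, map_binForm]
  simp [Coords.val]

theorem Coords.val_inr (v : Coords F) (i : Fin 2) : v.val (Sum.inr i) = v.z i := rfl

/-- Every section of `𝒪(m, l)` is of the form `∑ Aᵢ xᵐ⁻ⁱ yⁱ`. -/
theorem exists_eq_sum_baseForm {k m l : ℕ} {s : MvPolynomial (Fin 2 ⊕ Fin 2) F}
    (hs : s ∈ globalSections F k m l) :
    ∃ A : ℕ → F[X], (∀ i, (A i).natDegree ≤ l - i * k) ∧ (∀ i, l < i * k → A i = 0) ∧
      s = ∑ i ∈ Finset.range (m + 1),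
        baseForm (l - i * k) (A i) * (X (Sum.inr 0) ^ (m - i) * X (Sum.inr 1) ^ i) := by
  rw [s.as_sum]
  refine Finset.sum_induction _ (fun s : MvPolynomial (Fin 2 ⊕ Fin 2) F =>
    ∃ A : ℕ → F[X], (∀ i, (A i).natDegree ≤ l - i * k) ∧ (∀ i, l < i * k → A i = 0) ∧
      s = ∑ i ∈ Finset.range (m + 1),
        baseForm (l - i * k) (A i) * (X (Sum.inr 0) ^ (m - i) * X (Sum.inr 1) ^ i)) ?_ ?_ ?_
  · rintro _ _ ⟨A, h1, h2, rfl⟩ ⟨B, h3, h4, rfl⟩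
    refine ⟨A + B, fun i => ?_, fun i hi => ?_, ?_⟩
    · exact (Polynomial.natDegree_add_le_of_le (h1 i) (h3 i)).trans (max_self _).le
    · simp [h2 i hi, h4 i hi]
    · simp [baseForm_add, add_mul, Finset.sum_add_distrib]
  · exact ⟨0, by simp, by simp, by simp [baseForm_zero]⟩
  · intro d hd
    have hw := (mem_weightedHomogeneousSubmodule F _ _ _).1 hs (mem_support_iff.mp hd)
    rw [Finsupp.weight_apply, Finsupp.sum_fintype _ _ (by simp)] at hw
    simp only [Fintype.sum_sum_type, Fin.sum_univ_two, bidegree, Sum.elim_inl, Sum.elim_inr,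
      Matrix.cons_val_zero, Matrix.cons_val_one, Prod.ext_iff, Prod.fst_add, Prod.snd_add,
      Prod.smul_fst, Prod.smul_snd, smul_eq_mul] at hw
    obtain ⟨h1, h2⟩ := hw
    have h3 : d (Sum.inl 0) + d (Sum.inl 1) = l - d (Sum.inr 1) * k := by omega
    -- A single monomial contributes only to the coefficient indexed by its exponent of y.
    refine ⟨Pi.single (d (Sum.inr 1)) (.C (coeff d s) * .X ^ d (Sum.inl 0)), ?_, ?_, ?_⟩
    · intro i
      rcases eq_or_ne i (d (Sum.inr 1)) with rfl | hi
      · rw [Pi.single_eq_same]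
        exact (Polynomial.natDegree_C_mul_X_pow_le _ _).trans (by omega)
      · simp [Pi.single_eq_of_ne hi]
    · intro i hi
      rw [Pi.single_eq_of_ne]
      rintro rfl
      omega
    · rw [Finset.sum_eq_single (d (Sum.inr 1))]
      · rw [Pi.single_eq_same, baseForm_C_mul_X_pow (by omega), monomial_eq,
          Finsupp.prod_fintype _ _ (by simp)]
        simp only [Fintype.prod_sum_type, Fin.prod_univ_two]
        rw [← h3, add_tsub_cancel_left]
        have : m - d (Sum.inr 1) = d (Sum.inr 0) := by omega
        rw [this]
        ring
      · intro i _ hi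
        rw [Pi.single_eq_of_ne hi, baseForm_zero, zero_mul]
      · intro h
        simp only [Finset.mem_range, not_lt] at h
        omega

end Sections

/-! ### Curves of class `𝒪(1, h)` -/

section Curves

variable {F : Type*} [Field F] {a b : F[X]} {k r : ℕ}

/-- The form `a x + b y` of bidegree `(1, r + k)`. -/
def curve (k r : ℕ) (a b : F[X]) : MvPolynomial (Fin 2 ⊕ Fin 2) F :=
  baseForm (r + k) a * X (Sum.inr 0) + baseForm r b * X (Sum.inr 1)

theorem aeval_curve (v : Coords F) :
    aeval v.val (curve k r a b) =
      binForm (r + k) a (v.t 0) (v.t 1) * v.z 0 + binForm r b (v.t 0) (v.t 1) * v.z 1 := by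
  simp [curve, aeval_baseForm, Coords.val_inr]

theorem curve_mem (ha : a.natDegree ≤ r + k) (hb : b.natDegree ≤ r) :
    curve k r a b ∈ globalSections F k 1 (r + k) := by
  have h1 := baseForm_mul_pow_mem (k := k) (l := r + k) (m := 1) (i := 0) (p := a) (by omega)
    (by omega) (by omega)
  have h2 := baseForm_mul_pow_mem (k := k) (l := r + k) (m := 1) (i := 1) (p := b) (by omega)
    (by omega) (by omega)
  simp at h1 h2
  exact Submodule.add_mem _ h1 h2

/-- A common divisor divides a power of t₀ and a power of t₁. The exact-degree condition excludes a
common zero at [1 : 0], which coprimality of the dehomogenised polynomials does not see. -/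
theorem isRelPrime_baseForm (hab : IsCoprime a b) (ha : a.natDegree ≤ r + k)
    (hb : b.natDegree ≤ r) (hpr : a.degree = (r + k : ℕ) ∨ b.degree = r) :
    IsRelPrime (baseForm (r + k) a) (baseForm r b) := by
  intro d hda hdb
  obtain ⟨h1, h2⟩ := dvd_pow_of_dvd_binForm hab ha hb hpr hda hdb
  have hX : IsRelPrime (X (Sum.inl 0) : MvPolynomial (Fin 2 ⊕ Fin 2) F) (X (Sum.inl 1)) := by
    rw [(X_prime (i := (Sum.inl 0 : Fin 2 ⊕ Fin 2)) (R := F)).irreducible.isRelPrime_iff_not_dvd]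
    simp [X_dvd_X]
  exact hX.pow h1 h2

theorem isRelPrime_baseForm_mul_X (hab : IsCoprime a b) (ha : a.natDegree ≤ r + k)
    (hb : b.natDegree ≤ r) (hpr : a.degree = (r + k : ℕ) ∨ b.degree = r) (b0 : b ≠ 0) :
    IsRelPrime (baseForm r b) (baseForm (r + k) a * X (Sum.inr 0)) := by
  refine IsRelPrime.mul_right (isRelPrime_baseForm hab ha hb hpr).symm (IsRelPrime.symm ?_)
  rw [(X_prime (i := (Sum.inr 0 : Fin 2 ⊕ Fin 2)) (R := F)).irreducible.isRelPrime_iff_not_dvd]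
  intro h
  -- Setting x = 0 leaves the form b unchanged, so x cannot divide it.
  have h1 := map_dvd (aeval fun i => if i = Sum.inr 0 then 0 else X i :
    MvPolynomial (Fin 2 ⊕ Fin 2) F →ₐ[F] MvPolynomial (Fin 2 ⊕ Fin 2) F) h
  rw [baseForm, map_binForm] at h1
  simp only [aeval_X, if_true, reduceCtorEq, if_false, zero_dvd_iff] at h1
  exact baseForm_ne_zero hb b0 h1

/-- The form is linear in y, with leading coefficient b relatively prime to the constant term ax. -/
theorem irreducible_curve (hab : IsCoprime a b) (ha : a.natDegree ≤ r + k)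
    (hb : b.natDegree ≤ r) (hpr : a.degree = (r + k : ℕ) ∨ b.degree = r) (b0 : b ≠ 0) :
    Irreducible (curve k r a b) := by
  classical
  rw [curve, add_comm]
  refine irreducible_mul_X_add _ _ _ (baseForm_ne_zero hb b0) (inr_notMem_vars_baseForm _ _ _) ?_
    (isRelPrime_baseForm_mul_X hab ha hb hpr b0)
  intro h
  rcases Finset.mem_union.1 (vars_mul _ _ h) with h | h
  · exact inr_notMem_vars_baseForm _ _ _ h
  · simp at h

theorem isIntegralCurve_curve (hab : IsCoprime a b) (ha : a.natDegree ≤ r + k)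
    (hb : b.natDegree ≤ r) (hpr : a.degree = (r + k : ℕ) ∨ b.degree = r) (b0 : b ≠ 0) :
    IsIntegralCurve k 1 (r + k) (curve k r a b) :=
  ⟨curve_mem ha hb, irreducible_curve hab ha hb hpr b0⟩

/-- The restriction of `∑ Aᵢ x³⁻ⁱ yⁱ` to the curve `a x + b y = 0`. -/
theorem binForm_cubic {A : Type*} [CommRing A] [Algebra F A] (ha : a.natDegree ≤ r + k)
    (hb : b.natDegree ≤ r) {l : ℕ} {B : ℕ → F[X]} (hB : ∀ i, (B i).natDegree ≤ l - i * k)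
    (hB0 : ∀ i, i ≤ 3 → l < i * k → B i = 0) (u v : A) :
    binForm (l + 3 * r) (∑ i ∈ Finset.range 4, B i * (b ^ (3 - i) * (-a) ^ i)) u v =
      ∑ i ∈ Finset.range 4, binForm (l - i * k) (B i) u v *
        (binForm r b u v ^ (3 - i) * (-binForm (r + k) a u v) ^ i) := by
  rw [binForm_sum]
  refine Finset.sum_congr rfl fun i hi => ?_
  have hi3 : i ≤ 3 := by simp at hi; omega
  -- With truncated subtraction, the degree count is valid only when i k ≤ l; otherwise the
  -- coefficient is zero.
  rcases le_or_gt (i * k) l with hil | hil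
  · have e : l + 3 * r = l - i * k + ((3 - i) * r + i * (r + k)) := by
      have h1 : (3 - i) * r + i * r = 3 * r := by rw [← add_mul]; congr 1; omega
      rw [mul_add]
      omega
    have ha' : (-a).natDegree ≤ r + k := by rwa [Polynomial.natDegree_neg]
    rw [e, binForm_mul (hB i), binForm_mul, binForm_pow hb, binForm_pow ha', binForm_neg]
    · exact Polynomial.natDegree_pow_le_of_le _ hb
    · exact Polynomial.natDegree_pow_le_of_le _ ha'
    · exact Polynomial.natDegree_mul_le_of_le (Polynomial.natDegree_pow_le_of_le _ hb)
        (Polynomial.natDegree_pow_le_of_le _ ha')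
  · simp [hB0 i hi3 hil]

/-- The kernel of a nonzero linear form in two variables is the line spanned by (q, -p). -/
theorem exists_eq_smul_of_mul_add_mul_eq_zero {K : Type*} [Field K] {x y p q : K}
    (h : p * x + q * y = 0) (hpq : ¬(p = 0 ∧ q = 0)) (hxy : ¬(x = 0 ∧ y = 0)) :
    ∃ c : K, c ≠ 0 ∧ x = c * q ∧ y = c * -p := by
  by_cases hq : q = 0
  · have hp : p ≠ 0 := fun hp => hpq ⟨hp, hq⟩
    have hx : x = 0 := by simpa [hq, hp] using h
    refine ⟨-y / p, ?_, by simp [hx, hq], by field_simp⟩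
    have : y ≠ 0 := fun hy => hxy ⟨hx, hy⟩
    simp [this, hp]
  · refine ⟨x / q, ?_, by field_simp, ?_⟩
    · have : x ≠ 0 := by
        rintro rfl
        exact hxy ⟨rfl, by simpa [hq] using h⟩
      simp [this, hq]
    · field_simp
      linear_combination h

/-- A point of the curve `a x + b y = 0` is determined by its image in the base. -/
theorem exists_eq_smul_of_curve {K : Type*} [Field K] [Algebra F K] (hab : IsCoprime a b)
    (ha : a.natDegree ≤ r + k) (hb : b.natDegree ≤ r)
    (hpr : a.degree = (r + k : ℕ) ∨ b.degree = r) {t z : Fin 2 → K} (ht : t ≠ 0) (hz : z ≠ 0)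
    (h : binForm (r + k) a (t 0) (t 1) * z 0 + binForm r b (t 0) (t 1) * z 1 = 0) :
    ∃ c : K, c ≠ 0 ∧ z 0 = c * binForm r b (t 0) (t 1) ∧
      z 1 = c * -binForm (r + k) a (t 0) (t 1) := by
  refine exists_eq_smul_of_mul_add_mul_eq_zero h ?_ ?_
  · rintro ⟨h1, h2⟩
    obtain ⟨h3, h4⟩ := dvd_pow_of_dvd_binForm hab ha hb hpr (zero_dvd_iff.2 h1) (zero_dvd_iff.2 h2)
    apply ht
    funext j
    fin_cases j
    · exact eq_zero_of_pow_eq_zero (zero_dvd_iff.1 h3)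
    · exact eq_zero_of_pow_eq_zero (zero_dvd_iff.1 h4)
  · rintro ⟨h1, h2⟩
    apply hz
    funext j
    fin_cases j
    · exact h1
    · exact h2

/-- A section of `𝒪(3, l)` with more zeros on the curve `C` than the intersection number
`C · 𝒪(3, l)` vanishes on `C`. -/
theorem curve_dvd (hab : IsCoprime a b) (ha : a.natDegree ≤ r + k)
    (hb : b.natDegree ≤ r) (hpr : a.degree = (r + k : ℕ) ∨ b.degree = r) (b0 : b ≠ 0)
    {ι : Type*} (T : Finset ι) (v : ι → Coords F)
    (hv : ∀ i j, i ≠ j → (v i).t 0 * (v j).t 1 ≠ (v i).t 1 * (v j).t 0)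
    {l : ℕ} (hT : l + 3 * r < T.card) (hTc : ∀ i ∈ T, aeval (v i).val (curve k r a b) = 0)
    {s : MvPolynomial (Fin 2 ⊕ Fin 2) F} (hs : s ∈ globalSections F k 3 l)
    (hTs : ∀ i ∈ T, aeval (v i).val s = 0) : curve k r a b ∣ s := by
  obtain ⟨A, hA, hA0, rfl⟩ := exists_eq_sum_baseForm hs
  set S := ∑ i ∈ Finset.range 4, A i * (b ^ (3 - i) * (-a) ^ i) with hS
  have hSdeg : S.natDegree ≤ l + 3 * r := by
    refine Polynomial.natDegree_sum_le_of_forall_le _ _ fun i hi => ?_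
    have hi3 : i ≤ 3 := by simp at hi; omega
    rcases le_or_gt (i * k) l with hil | hil
    · have ha' : (-a).natDegree ≤ r + k := by rwa [Polynomial.natDegree_neg]
      refine (Polynomial.natDegree_mul_le_of_le (hA i) (Polynomial.natDegree_mul_le_of_le
        (Polynomial.natDegree_pow_le_of_le (3 - i) hb)
        (Polynomial.natDegree_pow_le_of_le i ha'))).trans ?_
      have h1 : (3 - i) * r + i * r = 3 * r := by rw [← add_mul]; congr 1; omega
      rw [mul_add]
      omega
    · simp [hA0 i hil]
  -- S is the pullback of the section along t ↦ (t; b, -a), a binary form of degree l + 3r with more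
  -- than l + 3r zeros.
  have hS0 : S = 0 := by
    by_contra hS0
    refine absurd (card_le_of_binForm_eq_zero T (fun i => (v i).t) (fun i => (v i).t_ne) hv hSdeg
      hS0 fun i hi => ?_) (by omega)
    have h1 := hTc i hi
    rw [aeval_curve] at h1
    obtain ⟨c, c0, h2, h3⟩ := exists_eq_smul_of_curve hab ha hb hpr (v i).t_ne (v i).z_ne h1
    have h4 := hTs i hi
    rw [hS, binForm_cubic ha hb hA fun i _ => hA0 i]
    simp only [map_sum, map_mul, map_pow, aeval_baseForm, aeval_X, Coords.val_inr, h2,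
      h3] at h4
    rw [← mul_eq_zero_iff_left (pow_ne_zero 3 c0), ← h4, Finset.mul_sum]
    refine Finset.sum_congr rfl fun j hj => ?_
    have : 3 = (3 - j) + j := by simp at hj; omega
    conv_lhs => rw [this, pow_add]
    rw [add_tsub_cancel_right]
    ring
  have hprime := (irreducible_curve hab ha hb hpr b0).prime
  have hS' := binForm_cubic ha hb hA (fun i _ => hA0 i)
    (X (Sum.inl 0) : MvPolynomial (Fin 2 ⊕ Fin 2) F) (X (Sum.inl 1))
  rw [← hS, hS0, binForm_zero] at hS'
  -- Modulo the curve, by ≡ -ax, so b³ s ≡ x³ S = 0. Primality then cancels b³.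
  have hdvd : curve k r a b ∣ baseForm r b ^ 3 * ∑ i ∈ Finset.range (3 + 1),
      baseForm (l - i * k) (A i) * (X (Sum.inr 0) ^ (3 - i) * X (Sum.inr 1) ^ i) := by
    have h1 : curve k r a b ∣ baseForm r b ^ 3 * ∑ i ∈ Finset.range (3 + 1),
        baseForm (l - i * k) (A i) * (X (Sum.inr 0) ^ (3 - i) * X (Sum.inr 1) ^ i) -
        X (Sum.inr 0) ^ 3 * ∑ i ∈ Finset.range 4, baseForm (l - i * k) (A i) *
        (baseForm r b ^ (3 - i) * (-baseForm (r + k) a) ^ i) := by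
      rw [Finset.mul_sum, Finset.mul_sum, ← Finset.sum_sub_distrib]
      refine Finset.dvd_sum fun i hi => ?_
      have hi3 : 3 = (3 - i) + i := by simp at hi; omega
      have h2 : curve k r a b ∣ (baseForm r b * X (Sum.inr 1)) ^ i -
          (-baseForm (r + k) a * X (Sum.inr 0)) ^ i := by
        refine dvd_trans (dvd_of_eq ?_) (sub_dvd_pow_sub_pow _ _ i)
        rw [curve]
        ring
      refine (h2.mul_left (baseForm (l - i * k) (A i) * X (Sum.inr 0) ^ (3 - i) *
        baseForm r b ^ (3 - i))).trans (dvd_of_eq ?_)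
      have e1 : baseForm r b ^ 3 = baseForm r b ^ (3 - i) * baseForm r b ^ i := by
        rw [← pow_add, ← hi3]
      have e2 : (X (Sum.inr 0) : MvPolynomial (Fin 2 ⊕ Fin 2) F) ^ 3 =
          X (Sum.inr 0) ^ (3 - i) * X (Sum.inr 0) ^ i := by
        rw [← pow_add, ← hi3]
      rw [e1, e2]
      ring
    have h3 : ∑ i ∈ Finset.range 4, baseForm (l - i * k) (A i) *
        (baseForm r b ^ (3 - i) * (-baseForm (r + k) a) ^ i) = 0 := hS'.symm
    rwa [h3, mul_zero, sub_zero] at h1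
  refine (hprime.dvd_or_dvd hdvd).resolve_left fun h => ?_
  have h1 := hprime.dvd_of_dvd_pow h
  have h2 : curve k r a b ∣ baseForm (r + k) a * X (Sum.inr 0) := by
    have : baseForm (r + k) a * X (Sum.inr 0) = curve k r a b - baseForm r b * X (Sum.inr 1) := by
      rw [curve]
      ring
    rw [this]
    exact dvd_sub dvd_rfl (h1.mul_right _)
  exact hprime.not_isUnit (isRelPrime_baseForm_mul_X hab ha hb hpr b0 h1 h2)

/-- A section of `𝒪(3, l)` with more than `l - 3 k` zeros on the curve `x = 0` vanishes on it. -/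
theorem X_dvd {ι : Type*} (T : Finset ι) (v : ι → Coords F)
    (hv : ∀ i j, i ≠ j → (v i).t 0 * (v j).t 1 ≠ (v i).t 1 * (v j).t 0)
    {l : ℕ} (hT : l < T.card + 3 * k) (hTc : ∀ i ∈ T, (v i).z 0 = 0)
    {s : MvPolynomial (Fin 2 ⊕ Fin 2) F} (hs : s ∈ globalSections F k 3 l)
    (hTs : ∀ i ∈ T, aeval (v i).val s = 0) : X (Sum.inr 0) ∣ s := by
  obtain ⟨A, hA, hA0, rfl⟩ := exists_eq_sum_baseForm hs
  -- On x = 0 only the term A₃ y³ survives, and A₃ has degree at most l - 3k.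
  have h3 : A 3 = 0 := by
    by_contra h0
    have hl : 3 * k ≤ l := by
      by_contra h
      exact h0 (hA0 3 (by omega))
    refine absurd (card_le_of_binForm_eq_zero T (fun i => (v i).t) (fun i => (v i).t_ne) hv (hA 3)
      h0 fun i hi => ?_) (by omega)
    have h4 := hTs i hi
    have hz : (v i).z 1 ≠ 0 := by
      intro h
      apply (v i).z_ne
      funext j
      fin_cases j
      · exact hTc i hi
      · exact h
    simp only [map_sum, map_mul, map_pow, aeval_baseForm, aeval_X, Coords.val_inr,
      hTc i hi] at h4
    simpa [Finset.sum_range_succ, hz] using h4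
  refine Finset.dvd_sum fun i hi => ?_
  rcases eq_or_ne i 3 with rfl | hi3
  · simp [h3, baseForm_zero]
  · have : 3 - i ≠ 0 := by simp at hi; omega
    exact ((dvd_pow_self _ this).mul_right _).mul_left _

end Curves

/-! ### Interpolation at the points of a marking -/

section Interpolation

variable {K : Type*} [Field K] {ι : Type*} [Finite ι]

/-- A space of functions separating the points outside `C`, and the points of `C` from each
other, contains all functions. -/
theorem eq_top_of_separates (W : Submodule K (ι → K)) (C : Set ι)
    (h₁ : ∀ i ∉ C, ∃ w ∈ W, w i ≠ 0 ∧ ∀ j, j ≠ i → w j = 0)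
    (h₂ : ∀ i ∈ C, ∃ w ∈ W, w i ≠ 0 ∧ ∀ j ∈ C, j ≠ i → w j = 0) : W = ⊤ := by
  classical
  have := Fintype.ofFinite ι
  have hsingle : ∀ i, (∃ w ∈ W, w i ≠ 0 ∧ ∀ j, j ≠ i → w j = 0) → Pi.single i (1 : K) ∈ W := by
    rintro i ⟨w, hw, hi, h0⟩
    have : Pi.single i (1 : K) = (w i)⁻¹ • w := by
      funext j
      rcases eq_or_ne j i with rfl | hj
      · simp [hi]
      · simp [hj, h0 j hj]
    rw [this]
    exact W.smul_mem _ hw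
  have hall : ∀ i, Pi.single i (1 : K) ∈ W := by
    intro i
    by_cases hi : i ∈ C
    · obtain ⟨w, hw, hwi, hw0⟩ := h₂ i hi
      -- The indicator functions outside C are already available, so the uncontrolled values of w
      -- there can be subtracted.
      refine hsingle i ⟨w - ∑ j ∈ Finset.univ.filter (· ∉ C), w j • Pi.single j (1 : K),
        W.sub_mem hw (W.sum_mem fun j hj => W.smul_mem _ (hsingle j (h₁ j (by simpa using hj)))),
        ?_, ?_⟩
      · rw [Pi.sub_apply, Finset.sum_apply, Finset.sum_eq_zero, sub_zero]
        · exact hwi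
        · intro j hj
          have : i ≠ j := by
            rintro rfl
            simp [hi] at hj
          simp [this]
      · intro j hj
        rw [Pi.sub_apply, Finset.sum_apply]
        by_cases hjC : j ∈ C
        · rw [Finset.sum_eq_zero, sub_zero]
          · exact hw0 j hjC hj
          · intro j' hj'
            have : j ≠ j' := by
              rintro rfl
              simp [hjC] at hj'
            simp [this]
        · rw [Finset.sum_eq_single j]
          · simp
          · intro j' _ hj'
            simp [hj'.symm]
          · simp [hjC]
    · exact hsingle i (h₁ i hi)
  rw [eq_top_iff]
  intro f _
  rw [pi_eq_sum_univ' f]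
  refine W.sum_mem fun i _ => W.smul_mem _ ?_
  exact hall i

variable {t z : ι → Fin 2 → K} (ht : ∀ i, t i ≠ 0) (hz : ∀ i, z i ≠ 0)
  (htt : ∀ i j, i ≠ j → t i 0 * t j 1 ≠ t i 1 * t j 0) {k l : ℕ} {W : Submodule K (ι → K)}
  (hW : ∀ i ≤ 3, i * k ≤ l → ∀ p : K[X], p.natDegree ≤ l - i * k →
    (fun P => binForm (l - i * k) p (t P 0) (t P 1) * (z P 0 ^ (3 - i) * z P 1 ^ i)) ∈ W)

include ht hz htt hW

/-- Sections A₀ x³ vanish on x = 0 and separate the points off it; sections A₃ y³ separate the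
points on it. The two bounds are the degrees available for A₀ and A₃. -/
theorem eq_top_of_card_X_le (h₀ : {i | z i 0 = 0}.ncard + 3 * k ≤ l)
    (h₁ : {i | z i 0 ≠ 0}.ncard ≤ l) : W = ⊤ := by
  classical
  have := Fintype.ofFinite ι
  refine eq_top_of_separates W {i | z i 0 = 0} (fun i hi => ?_) (fun i hi => ?_)
  · rw [Set.mem_ofPred_eq] at hi
    obtain ⟨p, hp, hp0, hpi⟩ := exists_binForm_ne_zero
      ((Finset.univ.filter fun j => z j 0 ≠ 0).erase i) t htt i (by simp) (ht i) (n := l) (by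
        refine (Finset.card_erase_le).trans (le_trans (le_of_eq ?_) h₁)
        rw [← Set.ncard_coe_finset]
        simp)
    refine ⟨_, hW 0 (by omega) (by omega) p (by simpa using hp), ?_, fun j hj => ?_⟩
    · simpa [hi] using hpi
    · by_cases hzj : z j 0 = 0
      · simp [hzj]
      · have := hp0 j (by simp [hj, hzj])
        simp [this]
  · rw [Set.mem_ofPred_eq] at hi
    obtain ⟨p, hp, hp0, hpi⟩ := exists_binForm_ne_zero
      ((Finset.univ.filter fun j => z j 0 = 0).erase i) t htt i (by simp) (ht i)
      (n := l - 3 * k) (by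
        refine (Finset.card_erase_le).trans (le_trans (le_of_eq ?_) (Nat.le_sub_of_add_le h₀))
        rw [← Set.ncard_coe_finset]
        simp)
    refine ⟨_, hW 3 (by omega) (by omega) p (by simpa using hp), ?_, fun j hj hji => ?_⟩
    · have : z i 1 ≠ 0 := by
        intro h
        apply hz i
        funext j
        fin_cases j
        · exact hi
        · exact h
      simpa [this] using hpi
    · have := hp0 j (by simpa [hji] using hj)
      simp [this]

/-- Off the curve, multiples of ax + by separate the points; on it, forms of degree l + 3r do so
after being lifted to sections of 𝒪(3, l). -/
theorem eq_top_of_card_curve_le {a b : K[X]} {r : ℕ} (hab : IsCoprime a b)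
    (ha : a.natDegree ≤ r + k) (hb : b.natDegree ≤ r)
    (hpr : a.degree = (r + k : ℕ) ∨ b.degree = r) (hl : r + 3 * k ≤ l)
    (h₀ : {i | binForm (r + k) a (t i 0) (t i 1) * z i 0 +
      binForm r b (t i 0) (t i 1) * z i 1 = 0}.ncard ≤ l + 3 * r)
    (h₁ : {i | binForm (r + k) a (t i 0) (t i 1) * z i 0 +
      binForm r b (t i 0) (t i 1) * z i 1 ≠ 0}.ncard ≤ l - 3 * k - r) : W = ⊤ := by
  classical
  have := Fintype.ofFinite ι
  set c : ι → K := fun i => binForm (r + k) a (t i 0) (t i 1) * z i 0 +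
    binForm r b (t i 0) (t i 1) * z i 1 with hc
  refine eq_top_of_separates W {i | c i = 0} (fun i hi => ?_) (fun i hi => ?_)
  · rw [Set.mem_ofPred_eq] at hi
    have hcard : ((Finset.univ.filter fun j => c j ≠ 0).erase i).card ≤ l - 3 * k - r := by
      refine (Finset.card_erase_le).trans (le_trans (le_of_eq ?_) h₁)
      rw [← Set.ncard_coe_finset]
      simp [hc]
    -- the product of `a x + b y` with `x²` or `y²` and a form on the base
    obtain ⟨e, he, hze⟩ : ∃ e, e ≤ 2 ∧ z i 0 ^ (2 - e) * z i 1 ^ e ≠ 0 := by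
      by_cases h : z i 0 = 0
      · refine ⟨2, le_rfl, ?_⟩
        have : z i 1 ≠ 0 := by
          intro h'
          apply hz i
          funext j
          fin_cases j
          · exact h
          · exact h'
        simpa using this
      · exact ⟨0, by omega, by simpa using h⟩
    have hek : e * k ≤ 2 * k := Nat.mul_le_mul_right _ he
    have hek' : (e + 1) * k = e * k + k := by ring
    -- Since e ≤ 2, the base degree left for p is at least l - 3k - r, the bound on the number of
    -- points off the curve.
    obtain ⟨p, hp, hp0, hpi⟩ := exists_binForm_ne_zero
      ((Finset.univ.filter fun j => c j ≠ 0).erase i) t htt i (by simp) (ht i)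
      (n := l - (r + k) - e * k) (by omega)
    have e1 : l - e * k = (l - (r + k) - e * k) + (r + k) := by omega
    have e2 : l - (e + 1) * k = (l - (r + k) - e * k) + r := by omega
    have hw := W.add_mem
      (hW e (by omega) (by omega) (p * a)
        ((Polynomial.natDegree_mul_le_of_le hp ha).trans e1.ge))
      (hW (e + 1) (by omega) (by omega) (p * b)
        ((Polynomial.natDegree_mul_le_of_le hp hb).trans e2.ge))
    have hval : ∀ j, ((fun P => binForm (l - e * k) (p * a) (t P 0) (t P 1) *
        (z P 0 ^ (3 - e) * z P 1 ^ e)) + (fun P => binForm (l - (e + 1) * k) (p * b) (t P 0) (t P 1) *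
        (z P 0 ^ (3 - (e + 1)) * z P 1 ^ (e + 1)))) j =
        binForm (l - (r + k) - e * k) p (t j 0) (t j 1) * c j *
          (z j 0 ^ (2 - e) * z j 1 ^ e) := by
      intro j
      simp only [Pi.add_apply, hc]
      rw [e1, e2, binForm_mul hp ha, binForm_mul hp hb]
      have h3 : 3 - e = 2 - e + 1 := by omega
      have h4 : 3 - (e + 1) = 2 - e := by omega
      rw [h3, h4]
      ring
    refine ⟨_, hw, ?_, fun j hj => ?_⟩
    · rw [hval]
      exact mul_ne_zero (mul_ne_zero hpi hi) hze
    · rw [hval]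
      by_cases hcj : c j = 0
      · simp [hcj]
      · have := hp0 j (by simp [hj, hcj])
        simp [this]
  · rw [Set.mem_ofPred_eq] at hi
    have hcard : ((Finset.univ.filter fun j => c j = 0).erase i).card ≤ l + 3 * r := by
      refine (Finset.card_erase_le).trans (le_trans (le_of_eq ?_) h₀)
      rw [← Set.ncard_coe_finset]
      simp [hc]
    obtain ⟨G, hG, hG0, hGi⟩ := exists_binForm_ne_zero
      ((Finset.univ.filter fun j => c j = 0).erase i) t htt i (by simp) (ht i) hcard
    obtain ⟨A, hA, hGA⟩ := exists_eq_cubic hab ha hb hpr hl hG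
    have hik : ∀ i ≤ 3, i * k ≤ l := fun i hi => (Nat.mul_le_mul_right k hi).trans (by omega)
    have hw : (∑ e ∈ Finset.range 4, fun P => binForm (l - e * k) (A e) (t P 0) (t P 1) *
        (z P 0 ^ (3 - e) * z P 1 ^ e)) ∈ W := by
      refine W.sum_mem fun e he => hW e ?_ (hik e ?_) _ (hA e)
      all_goals
        simp at he
        omega
    -- On the curve (x, y) = m (b, -a), so the lifted section takes the value m³ G(t).
    have hval : ∀ j, c j = 0 → ∃ m : K, m ≠ 0 ∧
        (∑ e ∈ Finset.range 4, fun P => binForm (l - e * k) (A e) (t P 0) (t P 1) *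
          (z P 0 ^ (3 - e) * z P 1 ^ e)) j =
          m * binForm (l + 3 * r) G (t j 0) (t j 1) := by
      intro j hj
      obtain ⟨m, hm, h2, h3⟩ := exists_eq_smul_of_curve hab ha hb hpr (ht j) (hz j) hj
      refine ⟨m ^ 3, pow_ne_zero 3 hm, ?_⟩
      rw [hGA, binForm_cubic ha hb hA (fun e he hl => absurd (hik e he) (by omega)),
        Finset.sum_apply, Finset.mul_sum]
      refine Finset.sum_congr rfl fun e he => ?_
      have : 3 = (3 - e) + e := by simp at he; omega
      conv_rhs => rw [this, pow_add]
      rw [add_tsub_cancel_right, h2, h3]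
      ring
    refine ⟨_, hw, ?_, fun j hj hji => ?_⟩
    · obtain ⟨m, hm, h⟩ := hval i hi
      rw [h]
      exact mul_ne_zero hm hGi
    · obtain ⟨m, hm, h⟩ := hval j hj
      rw [h, hG0 j (by simpa [hji] using hj), mul_zero]

end Interpolation

/-! ### The restriction map of a marking -/

section Restriction

variable {F : Type*} [Field F] {k : ℕ} {D : ReducedDivisor F} (M : Marking k D)

theorem Marking.mk_rep_mem (P : M.points) : Point.mk k (P : Point F k).rep ∈ M.points := by
  rw [Point.mk_rep]
  exact P.2

/-- The projection is injective on a marking, so distinct points have non-proportional base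
coordinates. -/
theorem Marking.t_ne (P Q : M.points) (h : P ≠ Q) :
    (P : Point F k).rep.t 0 * (Q : Point F k).rep.t 1 ≠
      (P : Point F k).rep.t 1 * (Q : Point F k).rep.t 0 := by
  intro h0
  apply h
  apply Subtype.ext
  apply M.bijOn.injOn P.2 Q.2
  have e : ∀ R : Point F k, Point.proj R = Projectivization.mk (Geom F) R.rep.t R.rep.t_ne := by
    intro R
    conv_lhs => rw [← Point.mk_rep R]
    rfl
  rw [e, e, Projectivization.mk_eq_mk_iff']
  set u := (P : Point F k).rep.t with hu
  set v := (Q : Point F k).rep.t with hv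
  have hv0 : v ≠ 0 := (Q : Point F k).rep.t_ne
  by_cases h1 : v 1 = 0
  · have h2 : v 0 ≠ 0 := by
      intro h2
      apply hv0
      funext j
      fin_cases j
      · exact h2
      · exact h1
    have h3 : u 1 = 0 := by simpa [h1, h2] using h0
    refine ⟨u 0 / v 0, ?_⟩
    funext j
    fin_cases j
    · simp [h2]
    · simp [h1, h3]
  · refine ⟨u 1 / v 1, ?_⟩
    funext j
    fin_cases j
    · simp only [Pi.smul_apply, smul_eq_mul, Fin.zero_eta]
      field_simp
      linear_combination -h0
    · simp [h1]

variable {M}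

theorem Marking.restriction_apply {m l : ℕ} (τ : M.Trivialization m l)
    (s : globalSections F k m l) (P : M.points) :
    (M.restriction τ s : M.points → Geom F) P =
      aeval (P : Point F k).rep.val (s : MvPolynomial (Fin 2 ⊕ Fin 2) F) /
        τ.toFun (P : Point F k).rep := rfl

theorem Marking.mem_ker_restriction_iff {m l : ℕ} (τ : M.Trivialization m l)
    (s : globalSections F k m l) : s ∈ LinearMap.ker (M.restriction τ) ↔
      ∀ P : M.points, aeval (P : Point F k).rep.val (s : MvPolynomial (Fin 2 ⊕ Fin 2) F) = 0 := by
  rw [LinearMap.mem_ker, ← Subtype.coe_inj, funext_iff]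
  refine forall_congr' fun P => ?_
  change _ / _ = (0 : Geom F) ↔ _
  rw [div_eq_zero_iff, or_iff_left (τ.ne_zero _ (M.mk_rep_mem P))]

/-- The restriction map of a marking is surjective if the forms over the algebraic closure attain
all values at its geometric points. -/
theorem Marking.restriction_surjective [PerfectField F] {l : ℕ} (τ : M.Trivialization 3 l)
    (h : ∀ W : Submodule (Geom F) (M.points → Geom F),
      (∀ i ≤ 3, i * k ≤ l → ∀ p : (Geom F)[X], p.natDegree ≤ l - i * k →
        (fun P : M.points => binForm (l - i * k) p ((P : Point F k).rep.t 0)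
          ((P : Point F k).rep.t 1) *
          ((P : Point F k).rep.z 0 ^ (3 - i) * (P : Point F k).rep.z 1 ^ i)) ∈ W) → W = ⊤) :
    Function.Surjective (M.restriction τ) := by
  rw [← LinearMap.range_eq_top]
  apply M.eq_top_of_span_eq_top
  set W := Submodule.span (Geom F) ((fun f : M.functions => (f : M.points → Geom F)) ''
    (LinearMap.range (M.restriction τ) : Set M.functions)) with hW
  set T : M.points → Geom F := fun P => τ.toFun (P : Point F k).rep with hT
  have hT0 : ∀ P, T P ≠ 0 := fun P => τ.ne_zero _ (M.mk_rep_mem P)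
  -- Multiplication by T⁻¹ accounts for the trivialization: restrictions are values of sections
  -- divided by T.
  have htop := h (W.comap (LinearMap.mulLeft (Geom F) T⁻¹)) ?_
  · rw [eq_top_iff]
    intro f _
    have h1 : T * f ∈ W.comap (LinearMap.mulLeft (Geom F) T⁻¹) := by
      rw [htop]
      trivial
    rw [Submodule.mem_comap, LinearMap.mulLeft_apply] at h1
    convert h1 using 1
    funext P
    simp [hT0 P]
  · intro i hi hil p hp
    rw [Submodule.mem_comap, LinearMap.mulLeft_apply]
    -- A form over the closure is a combination, with coefficients in the closure, of monomial
    -- sections defined over `F`.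
    have hsum : T⁻¹ * (fun P : M.points => binForm (l - i * k) p ((P : Point F k).rep.t 0)
          ((P : Point F k).rep.t 1) *
          ((P : Point F k).rep.z 0 ^ (3 - i) * (P : Point F k).rep.z 1 ^ i)) =
        ∑ j ∈ (Finset.range (l - i * k + 1)).attach, p.coeff j •
          (M.restriction τ ⟨_, baseForm_mul_pow_mem (F := F) hi hil (p := .X ^ (j : ℕ)) (by
            have := Finset.mem_range.1 j.2
            rw [Polynomial.natDegree_X_pow]
            omega)⟩ : M.points → Geom F) := by
      funext P
      rw [Finset.sum_apply, Pi.mul_apply, binForm_eq_sum hp, Finset.sum_mul, Finset.mul_sum,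
        ← Finset.sum_attach]
      refine Finset.sum_congr rfl fun j _ => ?_
      have hj : (j : ℕ) ≤ l - i * k := by
        have := Finset.mem_range.1 j.2
        omega
      rw [Pi.smul_apply, M.restriction_apply]
      simp only [map_mul, map_pow, aeval_baseForm, aeval_X, Coords.val_inr, binForm_X_pow hj,
        smul_eq_mul, Pi.inv_apply, hT]
      ring
    rw [hsum]
    exact W.sum_mem fun j _ => W.smul_mem _ (Submodule.subset_span ⟨_, ⟨_, rfl⟩, rfl⟩)

/-- If `2 (h + 1) - k > deg D`, there is a section of `𝒪(1, h)` vanishing on the marking. -/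
theorem Marking.exists_section_eq_zero [PerfectField F] (M : Marking k D) {h : ℕ}
    (hh : D.degree + k < 2 * (h + 1)) :
    ∃ A B : F[X], (A ≠ 0 ∨ B ≠ 0) ∧ A.natDegree ≤ h ∧ B.natDegree ≤ h - k ∧ (h < k → B = 0) ∧
      ∀ P : M.points, binForm h A ((P : Point F k).rep.t 0) ((P : Point F k).rep.t 1) *
        (P : Point F k).rep.z 0 + binForm (h - k) B ((P : Point F k).rep.t 0)
          ((P : Point F k).rep.t 1) * (P : Point F k).rep.z 1 = 0 := by
  obtain ⟨τ⟩ : Nonempty (M.Trivialization 1 h) := inferInstance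
  have := M.finite_functions
  have hdeg : ∀ n (p : Polynomial.degreeLT F n), (p : F[X]).natDegree ≤ n - 1 := by
    intro n p
    have := Polynomial.mem_degreeLT.1 p.2
    by_cases h0 : (p : F[X]) = 0
    · simp [h0]
    · rw [Polynomial.degree_eq_natDegree h0, Nat.cast_lt] at this
      omega
  have hzero : h < k → ∀ p : Polynomial.degreeLT F (h + 1 - k), (p : F[X]) = 0 := by
    intro hk p
    have h1 := Polynomial.mem_degreeLT.1 p.2
    have h0 : ((h + 1 - k : ℕ) : WithBot ℕ) = 0 := by
      rw [show h + 1 - k = 0 by omega, Nat.cast_zero]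
    exact Polynomial.degree_eq_bot.1 (Nat.WithBot.lt_zero_iff.1 (h1.trans_eq h0))
  let Φ : (Polynomial.degreeLT F (h + 1) × Polynomial.degreeLT F (h + 1 - k)) →ₗ[F]
      globalSections F k 1 h :=
    { toFun := fun p => ⟨baseForm h (p.1 : F[X]) * X (Sum.inr 0) +
        baseForm (h - k) (p.2 : F[X]) * X (Sum.inr 1), by
        refine Submodule.add_mem _ ?_ ?_
        · have := baseForm_mul_pow_mem (k := k) (l := h) (m := 1) (i := 0) (p := (p.1 : F[X]))
            (by omega) (by omega) (by simpa using hdeg _ p.1)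
          simpa using this
        · rcases le_or_gt k h with hk | hk
          · have := baseForm_mul_pow_mem (k := k) (l := h) (m := 1) (i := 1) (p := (p.2 : F[X]))
              (by omega) (by omega) ((hdeg _ p.2).trans (by omega))
            simpa using this
          · rw [hzero hk p.2, baseForm_zero, zero_mul]
            exact Submodule.zero_mem _⟩
      map_add' := by
        intro p q
        ext1
        simp [baseForm_add]
        ring
      map_smul' := by
        intro c p
        ext1
        simp [baseForm, binForm_smul] }
  -- The source has dimension (h + 1) + (h + 1 - k), and truncating the second term at 0 only
  -- increases it; the target has dimension at most deg D.
  have hker : LinearMap.ker ((M.restriction τ).comp Φ) ≠ ⊥ := by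
    apply LinearMap.ker_ne_bot_of_finrank_lt
    have h1 := M.finrank_functions_le
    rw [M.card_points] at h1
    have h2 : Module.finrank F (Polynomial.degreeLT F (h + 1) ×
        Polynomial.degreeLT F (h + 1 - k)) = (h + 1) + (h + 1 - k) := by
      rw [Module.finrank_prod, (Polynomial.degreeLTEquiv F _).finrank_eq,
        (Polynomial.degreeLTEquiv F _).finrank_eq, Module.finrank_fin_fun, Module.finrank_fin_fun]
    omega
  obtain ⟨⟨A, B⟩, hAB, hAB0⟩ := Submodule.exists_mem_ne_zero_of_ne_bot hker
  refine ⟨A, B, ?_, by simpa using hdeg _ A, (hdeg _ B).trans (by omega), (hzero · B), ?_⟩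
  · by_contra! h0
    apply hAB0
    ext1
    · exact Subtype.ext h0.1
    · exact Subtype.ext h0.2
  · have := (M.mem_ker_restriction_iff τ (Φ (A, B))).1 hAB
    intro P
    simpa [Φ, aeval_baseForm, Coords.val_inr] using this P

end Restriction

/-! ### Counting marking points on the auxiliary curve -/

section Dichotomy

variable {F : Type*} [Field F] {k : ℕ} {D : ReducedDivisor F}

/-- Coprime parts of two binary forms of degrees `h` and `h - k`. -/
theorem exists_coprime_parts {A B : F[X]} (hB : B ≠ 0) {h : ℕ} (hk : k ≤ h)
    (hA' : A.natDegree ≤ h) (hB' : B.natDegree ≤ h - k) :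
    ∃ (g a b : F[X]) (r : ℕ), A = g * a ∧ B = g * b ∧ g ≠ 0 ∧ IsCoprime a b ∧ b ≠ 0 ∧
      a.natDegree ≤ r + k ∧ b.natDegree ≤ r ∧ (a.degree = (r + k : ℕ) ∨ b.degree = r) ∧
      r + k + g.natDegree ≤ h := by
  classical
  let := EuclideanDomain.gcdMonoid F[X]
  obtain ⟨a, b, ha, hb, hu⟩ := extract_gcd A B
  set g := gcd A B
  have g0 : g ≠ 0 := fun h => hB (by rw [hb, h, zero_mul])
  have b0 : b ≠ 0 := fun h => hB (by rw [hb, h, mul_zero])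
  have hbd : g.natDegree + b.natDegree ≤ h - k := by
    rw [← Polynomial.natDegree_mul g0 b0, ← hb]
    exact hB'
  have hab : IsCoprime a b := (gcd_isUnit_iff a b).1 hu
  -- Choose r as the larger of deg b and deg a - k, the least value allowed. Any common zero of A
  -- and B at [1 : 0] thereby goes into the removed factor, viewed as a form of degree h - (r + k).
  rcases le_or_gt a.natDegree (b.natDegree + k) with hle | hlt
  · exact ⟨g, a, b, b.natDegree, ha, hb, g0, hab, b0, hle, le_rfl,
      Or.inr (Polynomial.degree_eq_natDegree b0), by omega⟩
  · have a0 : a ≠ 0 := by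
      rintro rfl
      simp at hlt
    have had : g.natDegree + a.natDegree ≤ h := by
      rw [← Polynomial.natDegree_mul g0 a0, ← ha]
      exact hA'
    refine ⟨g, a, b, a.natDegree - k, ha, hb, g0, hab, b0, by omega, by omega, Or.inl ?_, by omega⟩
    rw [Polynomial.degree_eq_natDegree a0, Nat.sub_add_cancel (by omega)]

/-- If the restriction map is not surjective, all sections in its kernel vanish on a common
curve of class `𝒪(1, h)`. -/
theorem Marking.surjective_or_exists_dvd [PerfectField F] (M : Marking k D) {l : ℕ}
    (hl : D.degree + 5 * k ≤ 2 * l) (τ : M.Trivialization 3 l) :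
    Function.Surjective (M.restriction τ) ∨
      ∃ (h : ℕ) (c : MvPolynomial (Fin 2 ⊕ Fin 2) F), IsIntegralCurve k 1 h c ∧
        ∀ s ∈ LinearMap.ker (M.restriction τ), c ∣ (s : MvPolynomial (Fin 2 ⊕ Fin 2) F) := by
  classical
  have := Fintype.ofFinite M.points
  set h := l - 2 * k with hh
  set v : M.points → Coords F := fun P => (P : Point F k).rep with hv
  have ht : ∀ P, (v P).t ≠ 0 := fun P => (v P).t_ne
  have hz : ∀ P, (v P).z ≠ 0 := fun P => (v P).z_ne
  have htt : ∀ P Q, P ≠ Q → (v P).t 0 * (v Q).t 1 ≠ (v P).t 1 * (v Q).t 0 := M.t_ne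
  obtain ⟨A, B, hAB, hA, hB, hB0, hv0⟩ := M.exists_section_eq_zero (h := h) (by omega)
  by_cases hBz : B = 0
  · have hA0 : A ≠ 0 := hAB.resolve_right (not_not.2 hBz)
    have hoff : {P | (v P).z 0 ≠ 0}.ncard ≤ h := by
      rw [Set.ncard_eq_toFinset_card']
      refine card_le_of_binForm_eq_zero _ (fun P => (v P).t) ht htt hA hA0 fun P hP => ?_
      have h1 := hv0 P
      rw [hBz, binForm_zero, zero_mul, add_zero] at h1
      exact (mul_eq_zero.1 h1).resolve_right (by simpa using hP)
    -- The threshold is l - 3k, the degree of 𝒪(3, l) on x = 0. Writing it additively also covers l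
    -- < 3k, where every section vanishes on this curve.
    by_cases hN : {P | (v P).z 0 = 0}.ncard + 3 * k ≤ l
    · left
      refine M.restriction_surjective τ fun W hW => ?_
      exact eq_top_of_card_X_le (t := fun P => (v P).t) (z := fun P => (v P).z) ht hz htt hW hN
        (hoff.trans (by omega))
    · right
      refine ⟨0, X (Sum.inr 0), ⟨X_mem_globalSections k (Sum.inr 0), X_prime.irreducible⟩, ?_⟩
      intro s hs
      rw [Set.ncard_eq_toFinset_card'] at hN
      exact X_dvd {P | (v P).z 0 = 0}.toFinset v htt (by omega) (by simp) s.2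
        fun P _ => (M.mem_ker_restriction_iff τ s).1 hs P
  · have hk : k ≤ h := by
      by_contra hk
      exact hBz (hB0 (by omega))
    obtain ⟨g, a, b, r, rfl, rfl, g0, hab, b0, ha, hb, hpr, hg⟩ :=
      exists_coprime_parts hBz hk hA hB
    have hg' : g.natDegree ≤ h - (r + k) := by omega
    -- The vanishing form is g times the curve, so off the curve g must vanish at the base point;
    -- distinct marking points have distinct base points.
    have hoff : {P | aeval (v P).val (curve k r a b) ≠ 0}.ncard ≤ h - (r + k) := by
      rw [Set.ncard_eq_toFinset_card']
      refine card_le_of_binForm_eq_zero _ (fun P => (v P).t) ht htt hg' g0 fun P hP => ?_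
      have h1 := hv0 P
      have e1 : h = h - (r + k) + (r + k) := by omega
      have e2 : h - k = h - (r + k) + r := by omega
      rw [e2, binForm_mul hg' hb, e1, binForm_mul (by omega) ha] at h1
      rw [add_tsub_cancel_right] at h1
      have h2 : aeval (v P).val (curve k r a b) ≠ 0 := by simpa using hP
      rw [aeval_curve] at h2
      refine (mul_eq_zero.1 (Eq.trans ?_ h1)).resolve_right h2
      ring
    -- The threshold l + 3r is the intersection number of the curve with 𝒪(3, l).
    by_cases hN : {P | aeval (v P).val (curve k r a b) = 0}.ncard ≤ l + 3 * r
    · left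
      refine M.restriction_surjective τ fun W hW => ?_
      have ha' : (a.map (algebraMap F (Geom F))).natDegree ≤ r + k := by simpa using ha
      have hb' : (b.map (algebraMap F (Geom F))).natDegree ≤ r := by simpa using hb
      refine eq_top_of_card_curve_le (t := fun P => (v P).t) (z := fun P => (v P).z) ht hz htt hW
        (hab.map (Polynomial.mapRingHom (algebraMap F (Geom F)))) ha' hb' (by simpa using hpr)
        (by omega) ?_ ?_
      · simpa [binForm_map_algebraMap, aeval_curve] using hN
      · simp only [aeval_curve] at hoff
        simp only [Polynomial.coe_mapRingHom, binForm_map_algebraMap]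
        exact hoff.trans (by omega)
    · right
      refine ⟨r + k, curve k r a b, isIntegralCurve_curve hab ha hb hpr b0, fun s hs => ?_⟩
      rw [Set.ncard_eq_toFinset_card'] at hN
      exact curve_dvd hab ha hb hpr b0 {P | aeval (v P).val (curve k r a b) = 0}.toFinset v htt
        (by omega) (by simp) s.2 fun P _ => (M.mem_ker_restriction_iff τ s).1 hs P

end Dichotomy

end Hirzebruch

end

theorem mainTheorem5 {F : Type*} [Field F] [Finite F] (k l : ℕ)
    (D : Hirzebruch.ReducedDivisor F) (M : Hirzebruch.Marking k D)
    (hl : (l : ℝ) - 2 * (k : ℝ) ≥ ((D.degree : ℝ) + (k : ℝ)) / 2)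
    (τ : M.Trivialization 3 l) :
    Function.Surjective (M.restriction τ) ∨
      ((∀ s ∈ LinearMap.ker (M.restriction τ),
          Hirzebruch.HorizontallyReducible k (s : MvPolynomial (Fin 2 ⊕ Fin 2) F)) ∧
        ∃ (h₀ : ℕ) (c : MvPolynomial (Fin 2 ⊕ Fin 2) F),
          Hirzebruch.IsIntegralCurve k 1 h₀ c ∧
          ∀ s ∈ LinearMap.ker (M.restriction τ),
            c ∣ (s : MvPolynomial (Fin 2 ⊕ Fin 2) F)) := by
  -- The integral form of the hypothesis; it also gives 2k ≤ l, so that l - 2k is a genuine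
  -- difference of natural numbers.
  have hl' : D.degree + 5 * k ≤ 2 * l := by
    have : (D.degree : ℝ) + 5 * k ≤ 2 * l := by linarith
    exact_mod_cast this
  refine (M.surjective_or_exists_dvd hl' τ).imp_right ?_
  rintro ⟨h, c, hc, hdvd⟩
  exact ⟨fun s hs => Hirzebruch.horizontallyReducible_of_dvd (by norm_num) s.2 hc (hdvd s hs),
    h, c, hc, hdvd⟩
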